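/- \textbf{Notation.} For parameters $a_j,b_j\in\mathbb C$ and $A_j,B_j>0$ with $\sum_j B_j-\sum_j A_j>0$, and for $z\in\mathbb C\setminus\{0\}$, Fox's $H$-function is $$H^{m,n}_{p,q}\!\left[z\,\middle|\,{(a_j,A_j)_{1,p}\atop (b_j,B_j)_{1,q}}\right]=\frac1{2\pi i}\int_L \frac{\prod_{j=1}^m\Gamma(b_j-B_j\xi)\prod_{j=1}^n\Gamma(1-a_j+A_j\xi)}{\prod_{j=m+1}^q\Gamma(1-b_j+B_j\xi)\prod_{j=n+1}^p\Gamma(a_j-A_j\xi)}\,z^\xi\,d\xi ,$$ where $z^\xi$ is the principal power and $L$ is a loop from $+\infty-iR$ to $+\infty+iR$ that encloses all poles of the $\Gamma(b_j-B_j\xi)$, $j\le m$, and none of the $\Gamma(1-a_j+A_j\xi)$, $j\le n$. For $\alpha>0$, $w\in\mathbb C\setminus\{0\}$, $\Re(\beta)>0$ and $\Re(\beta)+\min_{1\le j\le m}\Re(\alpha b_j/B_j)>0$ put $$\left(\mathcal H^{w;m,n;\alpha}_{a+;p,q;\beta}\phi\right)(x)=\int_a^x (x-t)^{\beta-1}H^{m,n}_{p,q}[w(x-t)^\alpha]\,\phi(t)\,dt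 .$$ For $\Re(\mu)>0$ let $(I^\mu_{a+}f)(x)=\frac1{\Gamma(\mu)}\int_a^x f(t)(x-t)^{\mu-1}dt$ and $(D^\mu_{a+}f)(x)=\left(\frac{d}{dx}\right)^n (I^{n-\mu}_{a+}f)(x)$, $n=[\Re(\mu)]+1$. \textbf{Statement.} Let $a<b$ be real, $\alpha>0$, $\eta>0$, $\nu\in\mathbb R$, $w\in\mathbb C\setminus\{0\}$, and let $\mu,\beta,\sigma\in\mathbb C$ satisfy $\Re(\mu)>0$, $\Re(\beta)>0$, $\Re(\sigma)>1/\eta-1$. Put $n=[\Re(\mu)]+1$ and assume that $\Re(\beta-\mu)>0$ and $\Re(\beta-\mu)+\min\{0,-\alpha(\eta\Re(\sigma)+\nu)\}>0$ (so that both operators below are defined). Let $\mathcal H^{w;2,0;\alpha}_{a+;1,2;\beta}$ be the operator whose kernel is the generalized Macdonald function $$H^{2,0}_{1,2}\!\left[z\,\middle|\,{(1-\frac{\nu+1}{\eta},\frac1\eta)\atop (0,1),\,(-\sigma-\frac{\nu}{\eta},\frac1\eta)}\right],$$ and let $\mathcal H^{w;2,2;\alpha}_{a+;3,4;\beta-\mu}$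 be the operator with kernel $$H^{2,2}_{3,4}\!\left[z\,\middle|\,{(1-\beta,\alpha),\,(1-\beta-n+\mu,\alpha),\,(1-\frac{\nu+1}{\eta},\frac1\eta)\atop (0,1),\,(-\sigma-\frac{\nu}{\eta},\frac1\eta),\,(1-\beta-n+\mu,\alpha),\,(1-\beta+\mu,\alpha)}\right].$$ Then for every $\phi\in L^1(a,b)$ the integrals and derivatives below exist and $$\left(D^\mu_{a+}\,\mathcal H^{w;2,0;\alpha}_{a+;1,2;\beta}\phi\right)(x)=\left(\mathcal H^{w;2,2;\alpha}_{a+;3,4;\beta-\mu}\phi\right)(x)$$ for almost every $x\in(a,b)$, and for every $x\in(a,b)$ if moreover $\phi$ is continuous on $(a,b)$. -/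

import Mathlib

open MeasureTheory Set Filter Topology

noncomputable section

/-- Riemann-Liouville fractional integral `(I^μ_{a+} f)(x)`, for `Re μ > 0`. -/
def rlIntegral (a : ℝ) (μ : ℂ) (f : ℝ → ℂ) (x : ℝ) : ℂ :=
  1 / Complex.Gamma μ * ∫ t in a..x, f t / ((x - t : ℝ) : ℂ) ^ (1 - μ)

/-- The number `n = [Re μ] + 1` of derivatives taken in `D^μ_{a+}`. -/
def rlOrder (μ : ℂ) : ℕ := ⌊μ.re⌋₊ + 1

/-- Riemann-Liouville fractional derivative `(D^μ_{a+} f)(x) = (d/dx)^n (I^{n-μ}_{a+} f)(x)`,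
with `n = [Re μ] + 1`. -/
def rlDeriv (a : ℝ) (μ : ℂ) (f : ℝ → ℂ) (x : ℝ) : ℂ :=
  iteratedDeriv (rlOrder μ) (rlIntegral a ((rlOrder μ : ℂ) - μ) f) x

/-- `(D^μ_{a+} f)(x)` exists: near `x` the integral defining `I^{n-μ}_{a+} f` converges absolutely,
`I^{n-μ}_{a+} f` is `n - 1` times continuously differentiable near `x`, and its derivative of
order `n - 1` is differentiable at `x` (here `n - 1 = [Re μ]`). -/
def RLDifferentiableAt (a : ℝ) (μ : ℂ) (f : ℝ → ℂ) (x : ℝ) : Prop :=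
  (∀ᶠ y in 𝓝 x, IntervalIntegrable
    (fun t : ℝ => f t / ((y - t : ℝ) : ℂ) ^ (1 - ((rlOrder μ : ℂ) - μ))) volume a y) ∧
  ContDiffAt ℝ (⌊μ.re⌋₊ : ℕ) (rlIntegral a ((rlOrder μ : ℂ) - μ) f) x ∧
  DifferentiableAt ℝ (iteratedDeriv ⌊μ.re⌋₊ (rlIntegral a ((rlOrder μ : ℂ) - μ) f)) x

/-- The parameters `(a_j, A_j)_{1,p}` and `(b_j, B_j)_{1,q}` of a Fox `H`-function. -/
structure FoxHParams (p q : ℕ) where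
  /-- upper parameters -/
  a : Fin p → ℂ
  /-- coefficients (positive) of the upper parameters -/
  A : Fin p → ℝ
  /-- lower parameters -/
  b : Fin q → ℂ
  /-- coefficients (positive) of the lower parameters -/
  B : Fin q → ℝ

/-- The Mellin-Barnes kernel
`∏_{j ≤ m} Γ(b_j - B_j ξ) ∏_{j ≤ n} Γ(1 - a_j + A_j ξ) /
  (∏_{j > m} Γ(1 - b_j + B_j ξ) ∏_{j > n} Γ(a_j - A_j ξ))`.
(`Complex.Gamma` is `0` at its poles, so `Γ⁻¹` is the entire function `1 / Γ`.) -/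
def foxTheta {p q : ℕ} (m n : ℕ) (P : FoxHParams p q) (ξ : ℂ) : ℂ :=
  (∏ j : Fin q, if (j : ℕ) < m then Complex.Gamma (P.b j - P.B j * ξ)
      else (Complex.Gamma (1 - P.b j + P.B j * ξ))⁻¹) *
  (∏ j : Fin p, if (j : ℕ) < n then Complex.Gamma (1 - P.a j + P.A j * ξ)
      else (Complex.Gamma (P.a j - P.A j * ξ))⁻¹)

/-- The loop `+∞ - iR → c - iR → c + iR → +∞ + iR` encloses all the poles `(b_j + k) / B_j` of
`Γ(b_j - B_j ξ)`, `j ≤ m`, and all the poles `(a_j - 1 - k) / A_j` of `Γ(1 - a_j + A_j ξ)`,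
`j ≤ n`, lie to the left of it. -/
def FoxSeparates {p q : ℕ} (m n : ℕ) (P : FoxHParams p q) (c R : ℝ) : Prop :=
  0 < R ∧
  (∀ j : Fin q, (j : ℕ) < m → ∀ k : ℕ,
    c < ((P.b j + k) / P.B j).re ∧ |((P.b j + k) / P.B j).im| < R) ∧
  (∀ j : Fin p, (j : ℕ) < n → ∀ k : ℕ, ((P.a j - 1 - k) / P.A j).re < c)

/-- `∫ f(ξ) dξ` along the loop `+∞ - iR → c - iR → c + iR → +∞ + iR`. -/
def loopIntegral (f : ℂ → ℂ) (c R : ℝ) : ℂ :=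
  -(∫ s in Ioi c, f (s - R * Complex.I))
    + Complex.I * (∫ y in (-R)..R, f (c + y * Complex.I))
    + ∫ s in Ioi c, f (s + R * Complex.I)

open Classical in
/-- Fox's function `H^{m,n}_{p,q}[z]`, that is `(1 / 2πi) ∫_L θ(ξ) z^ξ dξ`, where `θ` is the
Mellin-Barnes kernel and `L` is a loop from `+∞ - iR` to `+∞ + iR` that separates the two families
of poles. This is the definition for `∑ B_j - ∑ A_j > 0` (which makes the integral absolutely
convergent for all `z ≠ 0`) and for families of poles that a vertical line separates; the value
does not depend on the loop. -/
def foxH {p q : ℕ} (m n : ℕ) (P : FoxHParams p q) (z : ℂ) : ℂ :=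
  if h : ∃ L : ℝ × ℝ, FoxSeparates m n P L.1 L.2 then
    1 / (2 * Real.pi * Complex.I) *
      loopIntegral (fun ξ => foxTheta m n P ξ * z ^ ξ) h.choose.1 h.choose.2
  else 0

/-- The integrand of the operator `𝓗^{w;m,n;α}_{a+;p,q;β}`. -/
def hIntegrand {p q : ℕ} (m n : ℕ) (P : FoxHParams p q) (w : ℂ) (α : ℝ) (β : ℂ)
    (φ : ℝ → ℂ) (x t : ℝ) : ℂ :=
  ((x - t : ℝ) : ℂ) ^ (β - 1) * foxH m n P (w * (((x - t) ^ α : ℝ) : ℂ)) * φ t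

/-- The operator `(𝓗^{w;m,n;α}_{a+;p,q;β} φ)(x)`, the integral over `t` from `a` to `x` of
`(x - t)^(β - 1) H^{m,n}_{p,q}[w (x - t)^α] φ(t)`. -/
def hOperator {p q : ℕ} (m n : ℕ) (P : FoxHParams p q) (a : ℝ) (w : ℂ) (α : ℝ) (β : ℂ)
    (φ : ℝ → ℂ) (x : ℝ) : ℂ :=
  ∫ t in a..x, hIntegrand m n P w α β φ x t

/-- The integral defining `(𝓗^{w;m,n;α}_{a+;p,q;β} φ)(x)` converges absolutely. -/
def HOperatorExistsAt {p q : ℕ} (m n : ℕ) (P : FoxHParams p q) (a : ℝ) (w : ℂ) (α : ℝ) (β : ℂ)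
    (φ : ℝ → ℂ) (x : ℝ) : Prop :=
  IntervalIntegrable (hIntegrand m n P w α β φ x) volume a x

/-- The conditions `Re β > 0` and `Re β + min_{j ≤ m} Re (α b_j / B_j) > 0` under which
`𝓗^{w;m,n;α}_{a+;p,q;β}` is defined. -/
def HOperatorCondition {p q : ℕ} (m : ℕ) (P : FoxHParams p q) (α : ℝ) (β : ℂ) : Prop :=
  0 < β.re ∧ ∀ j : Fin q, (j : ℕ) < m → 0 < β.re + (α * P.b j / P.B j).re

/-- The parameters of the generalized Macdonald function
`λ^{(η)}_{σ,ν}[z] = H^{2,0}_{1,2}[z | (1-(ν+1)/η, 1/η); (0,1), (-σ-ν/η, 1/η)]`. -/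
def macdonaldParams (η : ℝ) (σ : ℂ) (ν : ℝ) : FoxHParams 1 2 where
  a := ![1 - (ν + 1) / η]
  A := ![1 / η]
  b := ![0, -σ - ν / η]
  B := ![1, 1 / η]

/-- The parameters of the composed kernel, with `n = [Re μ] + 1`: upper parameters
`(1-β, α), (1-β-n+μ, α), (1-(ν+1)/η, 1/η)`, lower parameters
`(0,1), (-σ-ν/η, 1/η), (1-β-n+μ, α), (1-β+μ, α)`. -/
def macdonaldDerivParams (η : ℝ) (σ : ℂ) (ν : ℝ) (α : ℝ) (β μ : ℂ) : FoxHParams 3 4 where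
  a := ![1 - β, 1 - β - (rlOrder μ : ℂ) + μ, 1 - (ν + 1) / η]
  A := ![α, α, 1 / η]
  b := ![0, -σ - ν / η, 1 - β - (rlOrder μ : ℂ) + μ, 1 - β + μ]
  B := ![1, 1 / η, α, α]

end

/-!
Along a loop `L` that encloses the poles of `Γ(-ξ) Γ(-σ - ν/η - ξ/η)`, the kernel
`t^(β - 1) H[w t^α]` of the left-hand operator is a superposition of powers of `t`, with exponents
`β - 1 + α ξ`, `ξ ∈ L`. Fractional integration of order `l` maps `t^(d - 1 + α ξ)` to
`Γ(d + α ξ) / Γ(d + l + α ξ) * t^(d + l - 1 + α ξ)`, by the Beta integral. So all kernels that occur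
belong to one family `macdonaldKernel … d`, in which the Mellin-Barnes kernel is multiplied by
`Γ(β + α ξ) / Γ(d + α ξ)`: the left-hand operator has `d = β`, the right-hand one `d = β - μ`
(after cancellation of `Γ(β + n - μ + α ξ)`), and fractional integration of order `l` raises `d`
by `l` (`volterra_cpow_macdonaldKernel`).

Consequently `I^(n - μ)` of the left-hand side is the Volterra operator with `d = β - μ + n`, and
the operators with `d = β - μ + j`, `j = 0, …, n`, form a tower of primitives (`IsKernelTower`),
because Volterra operators compose by convolving their kernels (`volterra_volterra`). This composition
holds at every point: the sum of the two orders of singularity is at least `1`, so the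
composed kernel is bounded. Differentiating `n` times descends the tower. All steps but the
last are instances of the fundamental theorem of calculus with a continuous integrand; the last one
is Lebesgue's differentiation theorem if `φ` is merely integrable, and again the fundamental
theorem of calculus if `φ` is continuous (`continuousOn_volterra`).

The analytic input is threefold. The functional equation of `Γ` alone bounds the Gamma quotients
along loops (`exists_norm_le_exp_of_step`): each step to the right multiplies `Γ(-ξ)` by an
arbitrarily small factor and the other quotients by a bounded one. By Cauchy's theorem, the value of
`foxH`, defined with a chosen loop, may be computed with any other admissible loop
(`loopIntegral_eq_loopIntegral`); a loop with `Re (β - μ + α ξ) > 0` is needed, which the second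
kernel's own separation condition does not guarantee. Finally, `Re (β - μ + α ξ) ≥ δ > 0`
makes the kernels `O(t^(δ - 1))` at `0`, hence integrable.
-/

/-! ### Exponential bounds for quotients of Gamma functions along loops -/

/-- The part `R ≤ |Im ξ| ≤ R'` of the half plane `Re ξ ≥ c`, together with the segment of the line
`Re ξ = c` that closes it. For `R = R'` this is the loop of `loopIntegral` itself. -/
def loopStrip (c R R' : ℝ) : Set ℂ :=
  {ξ | c ≤ ξ.re ∧ |ξ.im| ≤ R' ∧ (ξ.re = c ∨ R ≤ |ξ.im|)}

lemma isClosed_loopStrip (c R R' : ℝ) : IsClosed (loopStrip c R R') := by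
  have hre := Complex.continuous_re
  have him := Complex.continuous_im.abs
  exact (isClosed_le continuous_const hre).inter ((isClosed_le him continuous_const).inter
    ((isClosed_eq hre continuous_const).union (isClosed_le continuous_const him)))

/-- A function that grows by a factor of at most `exp (κ h)` under `ξ ↦ ξ + h` far to the right is
`O(exp (κ Re ξ))`: by compactness near the left end, by induction further right. -/
lemma exists_norm_le_exp_of_step {c R R' X h κ : ℝ} (hh : 0 < h) {F : ℂ → ℂ}
    (hF : ContinuousOn F (loopStrip c R R'))
    (hstep : ∀ ξ ∈ loopStrip c R R', X ≤ ξ.re → ‖F (ξ + h)‖ ≤ Real.exp (κ * h) * ‖F ξ‖) :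
    ∃ C, 0 ≤ C ∧ ∀ ξ ∈ loopStrip c R R', ‖F ξ‖ ≤ C * Real.exp (κ * ξ.re) := by
  set Y := max X c
  have hcomp : IsCompact (loopStrip c R R' ∩ {ξ | ξ.re ≤ Y + h}) := by
    refine Metric.isCompact_of_isClosed_isBounded
      ((isClosed_loopStrip c R R').inter (isClosed_le Complex.continuous_re continuous_const)) ?_
    have hb : Bornology.IsBounded (Icc c (Y + h) ×ℂ Icc (-R') R') :=
      (Metric.isBounded_Icc _ _).reProdIm (Metric.isBounded_Icc _ _)
    refine hb.subset ?_
    rintro ξ ⟨⟨h1, h2, _⟩, h3⟩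
    exact ⟨⟨h1, h3⟩, abs_le.1 h2⟩
  obtain ⟨C, hC⟩ := hcomp.exists_bound_of_continuousOn
    (f := fun ξ => (Real.exp (-(κ * ξ.re)) : ℂ) * F ξ)
    ((Complex.continuous_ofReal.comp (by fun_prop)).continuousOn.mul (hF.mono inter_subset_left))
  have hbase : ∀ ξ ∈ loopStrip c R R', ξ.re ≤ Y + h →
      ‖F ξ‖ ≤ max C 0 * Real.exp (κ * ξ.re) := by
    intro ξ hξ hle
    have h1 := hC ξ ⟨hξ, hle⟩
    rw [norm_mul, Complex.norm_real, Real.norm_of_nonneg (Real.exp_pos _).le, Real.exp_neg,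
      inv_mul_le_iff₀ (Real.exp_pos _)] at h1
    rw [mul_comm]
    exact h1.trans (mul_le_mul_of_nonneg_left (le_max_left _ _) (Real.exp_pos _).le)
  have hind : ∀ n : ℕ, ∀ ξ ∈ loopStrip c R R', ξ.re ≤ Y + h + n * h →
      ‖F ξ‖ ≤ max C 0 * Real.exp (κ * ξ.re) := by
    intro n
    induction n with
    | zero => intro ξ hξ hle; exact hbase ξ hξ (by simpa using hle)
    | succ n ih =>
      intro ξ hξ hle
      by_cases hcase : ξ.re ≤ Y + h
      · exact hbase ξ hξ hcase
      push Not at hcase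
      have hXY : X ≤ Y := le_max_left _ _
      have hcY : c ≤ Y := le_max_right _ _
      have hmem : ξ - h ∈ loopStrip c R R' := by
        refine ⟨?_, ?_, Or.inr ?_⟩
        · simp; linarith
        · simpa using hξ.2.1
        · rcases hξ.2.2 with h1 | h1
          · linarith
          · simpa using h1
      have h1 := hstep (ξ - h) hmem (by simp; linarith)
      have h2 := ih (ξ - h) hmem (by simp; push_cast at hle; linarith)
      rw [sub_add_cancel] at h1
      refine h1.trans ((mul_le_mul_of_nonneg_left h2 (Real.exp_pos _).le).trans (le_of_eq ?_))
      rw [mul_left_comm, ← Real.exp_add]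
      congr 2
      simp; ring
  refine ⟨max C 0, le_max_right _ _, fun ξ hξ => ?_⟩
  obtain ⟨n, hn⟩ := exists_nat_ge ((ξ.re - (Y + h)) / h)
  rw [div_le_iff₀ hh] at hn
  exact hind n ξ hξ (by linarith)

lemma differentiableAt_Gamma_sub_mul {c R t : ℝ} (ht : 0 < t) {b : ℂ}
    (hsep : ∀ k : ℕ, c < ((b + k) / t).re ∧ |((b + k) / t).im| < R)
    {ξ : ℂ} (hξ : ξ.re ≤ c ∨ R ≤ |ξ.im|) :
    DifferentiableAt ℂ (fun ξ => Complex.Gamma (b - t * ξ)) ξ := by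
  have hne : ∀ k : ℕ, b - t * ξ ≠ -k := by
    intro k h
    have ht' : (t : ℂ) ≠ 0 := by exact_mod_cast ht.ne'
    have h1 : (b + k) / t = ξ := by
      rw [div_eq_iff ht']; linear_combination h
    have h2 := hsep k
    rw [h1] at h2
    rcases hξ with h3 | h3
    · linarith [h2.1]
    · linarith [h2.2]
  exact DifferentiableAt.comp (f := fun ξ : ℂ => b - t * ξ) (g := Complex.Gamma) ξ
    (Complex.differentiableAt_Gamma _ hne) (by fun_prop)

lemma continuousOn_Gamma_sub_mul {c R R' t : ℝ} (ht : 0 < t) {b : ℂ}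
    (hsep : ∀ k : ℕ, c < ((b + k) / t).re ∧ |((b + k) / t).im| < R) :
    ContinuousOn (fun ξ => Complex.Gamma (b - t * ξ)) (loopStrip c R R') :=
  fun _ hξ => (differentiableAt_Gamma_sub_mul ht hsep
    (hξ.2.2.imp le_of_eq id)).continuousAt.continuousWithinAt

lemma le_norm_sub_mul_sub_one {t : ℝ} (b ξ : ℂ) : t * ξ.re + 1 - b.re ≤ ‖b - t * ξ - 1‖ := by
  have := Complex.abs_re_le_norm (b - t * ξ - 1)
  have h2 := neg_abs_le (b - t * ξ - 1).re
  simp at this h2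
  linarith

/-- `Γ(b - t ξ)` decays faster than every exponential along a loop: the functional equation yields
a factor `1 / |b - t ξ - 1|`, small far to the right, for every step of length `1 / t`. -/
lemma exists_norm_Gamma_sub_mul_le {c R R' t : ℝ} (ht : 0 < t) {b : ℂ}
    (hsep : ∀ k : ℕ, c < ((b + k) / t).re ∧ |((b + k) / t).im| < R) (κ : ℝ) :
    ∃ C, 0 ≤ C ∧ ∀ ξ ∈ loopStrip c R R',
      ‖Complex.Gamma (b - t * ξ)‖ ≤ C * Real.exp (κ * ξ.re) := by
  have ht' : (t : ℂ) ≠ 0 := by exact_mod_cast ht.ne'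
  refine exists_norm_le_exp_of_step (h := 1 / t)
    (X := (Real.exp (-(κ * (1 / t))) + b.re) / t) (by positivity)
    (continuousOn_Gamma_sub_mul ht hsep) ?_
  intro ξ hξ hX
  rw [div_le_iff₀ ht] at hX
  have h1 := le_norm_sub_mul_sub_one (t := t) b ξ
  have h2 : Real.exp (-(κ * (1 / t))) ≤ ‖b - t * ξ - 1‖ := by linarith
  have hne : b - t * ξ - 1 ≠ 0 := norm_pos_iff.1 ((Real.exp_pos _).trans_le h2)
  have h3 : b - t * (ξ + (1 / t : ℝ)) = b - t * ξ - 1 := by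
    push_cast; field_simp; ring
  have h4 := Complex.Gamma_add_one _ hne
  rw [sub_add_cancel] at h4
  rw [h3, h4, norm_mul, ← mul_assoc]
  refine le_mul_of_one_le_left (norm_nonneg _) ?_
  calc (1 : ℝ) = Real.exp (κ * (1 / t)) * Real.exp (-(κ * (1 / t))) := by
        rw [← Real.exp_add]; simp
    _ ≤ _ := by gcongr

/-- `Γ(b - t ξ) / Γ(a - t ξ)` grows at most exponentially along a loop. -/
lemma exists_norm_Gamma_sub_mul_div_le {c R R' t : ℝ} (ht : 0 < t) {b : ℂ} (a : ℂ)
    (hsep : ∀ k : ℕ, c < ((b + k) / t).re ∧ |((b + k) / t).im| < R) :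
    ∃ κ C, 0 ≤ C ∧ ∀ ξ ∈ loopStrip c R R',
      ‖Complex.Gamma (b - t * ξ) * (Complex.Gamma (a - t * ξ))⁻¹‖ ≤ C * Real.exp (κ * ξ.re) := by
  have ht' : (t : ℂ) ≠ 0 := by exact_mod_cast ht.ne'
  refine ⟨t * Real.log 2, exists_norm_le_exp_of_step (h := 1 / t)
    (X := (‖a - b‖ + b.re) / t) (by positivity)
    ((continuousOn_Gamma_sub_mul ht hsep).mul
      (Complex.differentiable_one_div_Gamma.continuous.comp (by fun_prop)).continuousOn) ?_⟩
  intro ξ hξ hX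
  rw [div_le_iff₀ ht] at hX
  have h1 := le_norm_sub_mul_sub_one (t := t) b ξ
  have h2 : ‖a - b‖ + 1 ≤ ‖b - t * ξ - 1‖ := by linarith
  have hne : b - t * ξ - 1 ≠ 0 := norm_pos_iff.1 (by linarith [norm_nonneg (a - b)])
  have h3 : ∀ z : ℂ, z - t * (ξ + (1 / t : ℝ)) = z - t * ξ - 1 := by
    intro z; push_cast; field_simp; ring
  have h4 := Complex.Gamma_add_one _ hne
  rw [sub_add_cancel] at h4
  have h5 := Complex.one_div_Gamma_eq_self_mul_one_div_Gamma_add_one (a - t * ξ - 1)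
  rw [sub_add_cancel] at h5
  have h6 : ‖a - t * ξ - 1‖ ≤ 2 * ‖b - t * ξ - 1‖ := by
    have : a - t * ξ - 1 = (b - t * ξ - 1) + (a - b) := by ring
    rw [this]
    refine (norm_add_le _ _).trans (by linarith)
  have h7 : Real.exp (t * Real.log 2 * (1 / t)) = 2 := by
    rw [mul_assoc, mul_comm, mul_assoc, one_div, inv_mul_cancel₀ ht.ne', mul_one,
      Real.exp_log two_pos]
  simp only [h3]
  rw [h7, h4, h5]
  simp only [norm_mul]
  calc _ ≤ ‖Complex.Gamma (b - t * ξ - 1)‖ *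
        (2 * ‖b - t * ξ - 1‖ * ‖(Complex.Gamma (a - t * ξ))⁻¹‖) := by gcongr
    _ = _ := by ring

/-- `Γ(u + α ξ) / Γ(v + α ξ)` grows at most exponentially along a loop to the right of the poles. -/
lemma exists_norm_Gamma_add_mul_div_le {c α : ℝ} (R R' : ℝ) (hα : 0 < α) {u : ℂ} (v : ℂ)
    (hu : 0 < u.re + α * c) :
    ∃ κ C, 0 ≤ C ∧ ∀ ξ ∈ loopStrip c R R',
      ‖Complex.Gamma (u + α * ξ) * (Complex.Gamma (v + α * ξ))⁻¹‖ ≤ C * Real.exp (κ * ξ.re) := by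
  have hα' : (α : ℂ) ≠ 0 := by exact_mod_cast hα.ne'
  have hpos : ∀ ξ ∈ loopStrip c R R', 0 < (u + α * ξ).re := by
    intro ξ hξ
    have := mul_le_mul_of_nonneg_left hξ.1 hα.le
    simp; linarith
  refine ⟨α * Real.log 2, exists_norm_le_exp_of_step (h := 1 / α)
    (X := (‖u - v‖ - v.re + 1) / α) (by positivity) (ContinuousOn.mul ?_
      (Complex.differentiable_one_div_Gamma.continuous.comp (by fun_prop)).continuousOn) ?_⟩
  · intro ξ hξ
    refine ContinuousAt.continuousWithinAt (ContinuousAt.comp (f := fun ξ : ℂ => u + α * ξ)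
      (g := Complex.Gamma) (Complex.differentiableAt_Gamma _ ?_).continuousAt (by fun_prop))
    intro m hm
    have h0 := hpos ξ hξ
    rw [hm] at h0
    simp at h0
    linarith [(Nat.cast_nonneg m : (0 : ℝ) ≤ m)]
  intro ξ hξ hX
  rw [div_le_iff₀ hα] at hX
  have h1 : ‖u - v‖ + 1 ≤ ‖v + α * ξ‖ := by
    have := Complex.abs_re_le_norm (v + α * ξ)
    have h2 := le_abs_self (v + α * ξ).re
    simp at this h2
    linarith
  have h3 : ∀ z : ℂ, z + α * (ξ + (1 / α : ℝ)) = z + α * ξ + 1 := by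
    intro z; push_cast; field_simp; ring
  have hne : u + α * ξ ≠ 0 := by
    intro h; have := hpos ξ hξ; rw [h] at this; simp at this
  have h4 := Complex.Gamma_add_one _ hne
  have h5 := Complex.one_div_Gamma_eq_self_mul_one_div_Gamma_add_one (v + α * ξ)
  have h6 : ‖u + α * ξ‖ ≤ 2 * ‖v + α * ξ‖ := by
    have : u + α * ξ = (v + α * ξ) + (u - v) := by ring
    rw [this]
    refine (norm_add_le _ _).trans (by linarith)
  have h7 : Real.exp (α * Real.log 2 * (1 / α)) = 2 := by
    rw [mul_assoc, mul_comm, mul_assoc, one_div, inv_mul_cancel₀ hα.ne', mul_one,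
      Real.exp_log two_pos]
  simp only [h3]
  rw [h7, h4, h5]
  simp only [norm_mul]
  calc _ ≤ 2 * ‖v + α * ξ‖ * ‖Complex.Gamma (u + α * ξ)‖ *
        ‖(Complex.Gamma (v + α * ξ + 1))⁻¹‖ := by gcongr
    _ = _ := by ring

/-! ### Loop integrals: independence of the loop, and parametrisation by the real line -/

lemma integrableOn_horizontal_ray {f : ℂ → ℂ} {c y C : ℝ}
    (hcont : ∀ s : ℝ, c ≤ s → ContinuousAt f (s + y * Complex.I))
    (hdecay : ∀ s : ℝ, c ≤ s → ‖f (s + y * Complex.I)‖ ≤ C * Real.exp (-s)) :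
    IntegrableOn (fun s : ℝ => f (s + y * Complex.I)) (Ioi c) := by
  refine Integrable.mono' ((integrableOn_exp_neg_Ioi c).const_mul C) ?_ ?_
  · refine ContinuousOn.aestronglyMeasurable (fun s hs => ?_) measurableSet_Ioi
    exact (ContinuousAt.comp (f := fun s : ℝ => (s : ℂ) + y * Complex.I)
      (hcont s (le_of_lt hs)) (by fun_prop)).continuousWithinAt
  · exact (ae_restrict_mem measurableSet_Ioi).mono fun s hs => hdecay s (le_of_lt hs)

/-- Cauchy's theorem for a half strip. -/
lemma integral_ray_sub_integral_ray {f : ℂ → ℂ} {c y₁ y₂ C : ℝ} (hy : y₁ ≤ y₂)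
    (hd : ∀ ξ : ℂ, c ≤ ξ.re → y₁ ≤ ξ.im → ξ.im ≤ y₂ → DifferentiableAt ℂ f ξ)
    (hdecay : ∀ ξ : ℂ, c ≤ ξ.re → y₁ ≤ ξ.im → ξ.im ≤ y₂ → ‖f ξ‖ ≤ C * Real.exp (-ξ.re)) :
    (∫ s in Ioi c, f (s + y₁ * Complex.I)) - (∫ s in Ioi c, f (s + y₂ * Complex.I)) =
      Complex.I * ∫ y in y₁..y₂, f (c + y * Complex.I) := by
  have hint : ∀ y : ℝ, y₁ ≤ y → y ≤ y₂ →
      IntegrableOn (fun s : ℝ => f (s + y * Complex.I)) (Ioi c) := fun y h1 h2 =>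
    integrableOn_horizontal_ray (C := C)
      (fun s hs => (hd _ (by simpa using hs) (by simpa using h1)
        (by simpa using h2)).continuousAt)
      (fun s hs => by
        simpa using hdecay (s + y * Complex.I) (by simpa using hs) (by simpa using h1)
          (by simpa using h2))
  have hrect : ∀ X : ℝ, c ≤ X →
      (∫ s in c..X, f (s + y₁ * Complex.I)) - (∫ s in c..X, f (s + y₂ * Complex.I)) +
        Complex.I * (∫ y in y₁..y₂, f (X + y * Complex.I)) -
        Complex.I * (∫ y in y₁..y₂, f (c + y * Complex.I)) = 0 := by
    intro X hX
    have := Complex.integral_boundary_rect_eq_zero_of_differentiableOn f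
      (c + y₁ * Complex.I) (X + y₂ * Complex.I) ?_
    · simpa using this
    · rintro ξ ⟨h1, h2⟩
      simp only [Complex.add_re, Complex.ofReal_re, Complex.mul_re, Complex.I_re, mul_zero,
        Complex.ofReal_im, Complex.I_im, mul_one, sub_self, add_zero, Complex.add_im,
        Complex.mul_im, zero_add] at h1 h2
      rw [uIcc_of_le hX] at h1
      rw [uIcc_of_le hy] at h2
      exact (hd ξ h1.1 h2.1 h2.2).differentiableWithinAt
  have hvert : Tendsto (fun X : ℝ => Complex.I * ∫ y in y₁..y₂, f (X + y * Complex.I)) atTop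
      (𝓝 0) := by
    have hlim : Tendsto (fun X : ℝ => C * Real.exp (-X) * |y₂ - y₁|) atTop (𝓝 0) := by
      simpa using (Real.tendsto_exp_neg_atTop_nhds_zero.const_mul C).mul_const |y₂ - y₁|
    refine squeeze_zero_norm' ?_ hlim
    filter_upwards [eventually_ge_atTop c] with X hX
    rw [norm_mul, Complex.norm_I, one_mul]
    refine intervalIntegral.norm_integral_le_of_norm_le_const fun y hyy => ?_
    rw [uIoc_of_le hy] at hyy
    simpa using hdecay (X + y * Complex.I) (by simpa using hX) (by simpa using hyy.1.le)
      (by simpa using hyy.2)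
  have h1 := intervalIntegral_tendsto_integral_Ioi c (hint y₁ le_rfl hy) tendsto_id
  have h2 := intervalIntegral_tendsto_integral_Ioi c (hint y₂ hy le_rfl) tendsto_id
  have h3 := ((h1.sub h2).add hvert).sub_const
    (Complex.I * (∫ y in y₁..y₂, f (c + y * Complex.I)))
  have h4 := tendsto_nhds_unique h3 (tendsto_const_nhds.congr' (by
    filter_upwards [eventually_ge_atTop c] with X hX using (hrect X hX).symm))
  linear_combination h4

lemma loopIntegral_eq_of_le_height {f : ℂ → ℂ} {c R R' C : ℝ} (hR : 0 ≤ R) (hRR : R ≤ R')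
    (hd : ∀ ξ ∈ loopStrip c R R', DifferentiableAt ℂ f ξ)
    (hdecay : ∀ ξ ∈ loopStrip c R R', ‖f ξ‖ ≤ C * Real.exp (-ξ.re)) :
    loopIntegral f c R = loopIntegral f c R' := by
  have hup : ∀ ξ : ℂ, c ≤ ξ.re → R ≤ ξ.im → ξ.im ≤ R' → ξ ∈ loopStrip c R R' :=
    fun ξ h1 h2 h3 => ⟨h1, by rw [abs_of_nonneg (hR.trans h2)]; exact h3,
      Or.inr (h2.trans (le_abs_self _))⟩
  have hdown : ∀ ξ : ℂ, c ≤ ξ.re → -R' ≤ ξ.im → ξ.im ≤ -R → ξ ∈ loopStrip c R R' := by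
    intro ξ h1 h2 h3
    have h4 : |ξ.im| = -ξ.im := abs_of_nonpos (by linarith)
    exact ⟨h1, by rw [h4]; linarith, Or.inr (by rw [h4]; linarith)⟩
  have h1 := integral_ray_sub_integral_ray hRR (fun ξ a b c => hd ξ (hup ξ a b c))
    (fun ξ a b c => hdecay ξ (hup ξ a b c))
  have h2 := integral_ray_sub_integral_ray (neg_le_neg hRR) (fun ξ a b c => hd ξ (hdown ξ a b c))
    (fun ξ a b c => hdecay ξ (hdown ξ a b c))
  have hvert : ∀ y₁ y₂ : ℝ, y₁ ∈ Icc (-R') R' → y₂ ∈ Icc (-R') R' →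
      IntervalIntegrable (fun y : ℝ => f (c + y * Complex.I)) volume y₁ y₂ := by
    intro y₁ y₂ hy₁ hy₂
    refine ContinuousOn.intervalIntegrable fun y hy => ?_
    have hy' : y ∈ Icc (-R') R' := (uIcc_subset_Icc hy₁ hy₂) hy
    refine (ContinuousAt.comp (f := fun s : ℝ => (c : ℂ) + s * Complex.I)
      (hd _ ?_).continuousAt (by fun_prop)).continuousWithinAt
    exact ⟨by simp, by simpa using abs_le.2 hy', Or.inl (by simp)⟩
  have m1 : -R' ∈ Icc (-R') R' := ⟨le_rfl, by linarith⟩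
  have m2 : -R ∈ Icc (-R') R' := ⟨by linarith, by linarith⟩
  have m3 : R ∈ Icc (-R') R' := ⟨by linarith, by linarith⟩
  have m4 : R' ∈ Icc (-R') R' := ⟨by linarith, by linarith⟩
  have h3 := intervalIntegral.integral_add_adjacent_intervals (hvert _ _ m1 m2) (hvert _ _ m2 m3)
  have h4 := intervalIntegral.integral_add_adjacent_intervals (hvert _ _ m1 m3) (hvert _ _ m3 m4)
  unfold loopIntegral
  simp only [Complex.ofReal_neg, neg_mul, ← sub_eq_add_neg] at h1 h2 h3 h4 ⊢
  rw [← h4, ← h3]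
  linear_combination h1 + h2

lemma loopIntegral_eq_of_le_left {f : ℂ → ℂ} {c c' R C : ℝ} (hR : 0 ≤ R) (hc : c ≤ c')
    (hd : ∀ ξ : ℂ, c ≤ ξ.re → |ξ.im| ≤ R → (ξ.re ≤ c' ∨ R ≤ |ξ.im|) → DifferentiableAt ℂ f ξ)
    (hdecay : ∀ ξ : ℂ, c ≤ ξ.re → |ξ.im| = R → ‖f ξ‖ ≤ C * Real.exp (-ξ.re)) :
    loopIntegral f c R = loopIntegral f c' R := by
  have hint : ∀ y : ℝ, |y| = R → ∀ x, c ≤ x →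
      IntegrableOn (fun s : ℝ => f (s + y * Complex.I)) (Ioi x) := fun y h1 x hx =>
    integrableOn_horizontal_ray (C := C)
      (fun s hs => (hd _ (by simpa using hx.trans hs) (by simpa using h1.le)
        (Or.inr (by simpa using h1.ge))).continuousAt)
      (fun s hs => by
        simpa using hdecay (s + y * Complex.I) (by simpa using hx.trans hs) (by simpa using h1))
  have hsplit : ∀ y : ℝ, |y| = R → (∫ s in Ioi c, f (s + y * Complex.I)) =
      (∫ s in c..c', f (s + y * Complex.I)) + ∫ s in Ioi c', f (s + y * Complex.I) :=
    fun y hy => (intervalIntegral.integral_interval_add_Ioi (hint y hy c le_rfl)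
      (hint y hy c' hc)).symm
  have hrect := Complex.integral_boundary_rect_eq_zero_of_differentiableOn f
      (c + (-R : ℝ) * Complex.I) (c' + R * Complex.I) (by
    rintro ξ ⟨h1, h2⟩
    simp only [Complex.add_re, Complex.ofReal_re, Complex.mul_re, Complex.I_re, mul_zero,
      Complex.ofReal_im, Complex.I_im, mul_one, sub_self, add_zero, Complex.add_im,
      Complex.mul_im, zero_add] at h1 h2
    rw [uIcc_of_le hc] at h1
    rw [uIcc_of_le (by linarith)] at h2
    exact (hd ξ h1.1 (abs_le.2 h2) (Or.inl h1.2)).differentiableWithinAt)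
  have s1 := hsplit R (abs_of_nonneg hR)
  have s2 := hsplit (-R) (by rw [abs_neg, abs_of_nonneg hR])
  unfold loopIntegral
  simp [← sub_eq_add_neg] at s2 hrect ⊢
  rw [s1, s2]
  linear_combination -hrect

/-- The loop integral does not depend on the loop, as long as the function is holomorphic between
the two loops and decays exponentially. -/
lemma loopIntegral_eq_loopIntegral {f : ℂ → ℂ} {c₁ c₂ R₁ R₂ C : ℝ} (h₁ : 0 ≤ R₁) (h₂ : 0 ≤ R₂)
    (hd : ∀ ξ : ℂ, min c₁ c₂ ≤ ξ.re → (ξ.re ≤ max c₁ c₂ ∨ min R₁ R₂ ≤ |ξ.im|) →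
      DifferentiableAt ℂ f ξ)
    (hdecay : ∀ ξ ∈ loopStrip (min c₁ c₂) (min R₁ R₂) (max R₁ R₂),
      ‖f ξ‖ ≤ C * Real.exp (-ξ.re)) :
    loopIntegral f c₁ R₁ = loopIntegral f c₂ R₂ := by
  have hbdd : ∀ c, min c₁ c₂ ≤ c → c ≤ max c₁ c₂ → ∀ R, min R₁ R₂ ≤ R → ∃ C', ∀ ξ ∈
      loopStrip c R (max R₁ R₂), ‖f ξ‖ ≤ C' * Real.exp (-ξ.re) := by
    intro c hc hc' R hR
    -- on the vertical segment the bound holds by compactness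
    have hcomp : IsCompact ({c} ×ℂ Icc (-(max R₁ R₂)) (max R₁ R₂)) :=
      isCompact_singleton.reProdIm isCompact_Icc
    obtain ⟨C₀, hC₀⟩ := hcomp.exists_bound_of_continuousOn (f := f) (by
      rintro ξ ⟨hξ, -⟩
      have hξ' : ξ.re = c := hξ
      exact (hd ξ (by rw [hξ']; exact hc)
        (Or.inl (by rw [hξ']; exact hc'))).continuousAt.continuousWithinAt)
    refine ⟨max C (C₀ * Real.exp c), fun ξ hξ => ?_⟩
    rcases hξ.2.2 with h | h
    · have := hC₀ ξ ⟨h, abs_le.1 hξ.2.1⟩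
      have h' : C₀ = C₀ * Real.exp c * Real.exp (-ξ.re) := by
        rw [mul_assoc, ← Real.exp_add, h]; simp
      rw [h'] at this
      exact this.trans (mul_le_mul_of_nonneg_right (le_max_right _ _) (Real.exp_pos _).le)
    · exact (hdecay ξ ⟨hc.trans hξ.1, hξ.2.1, Or.inr (hR.trans h)⟩).trans
        (mul_le_mul_of_nonneg_right (le_max_left _ _) (Real.exp_pos _).le)
  have hheight : ∀ c R, min c₁ c₂ ≤ c → c ≤ max c₁ c₂ → min R₁ R₂ ≤ R → R ≤ max R₁ R₂ → 0 ≤ R →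
      loopIntegral f c R = loopIntegral f c (max R₁ R₂) := by
    intro c R hc hc' hR hR' h0
    obtain ⟨C', hC'⟩ := hbdd c hc hc' R hR
    refine loopIntegral_eq_of_le_height h0 hR' (fun ξ hξ => hd ξ (hc.trans hξ.1) ?_) hC'
    rcases hξ.2.2 with h | h
    · exact Or.inl (h.le.trans hc')
    · exact Or.inr (hR.trans h)
  have hleft : loopIntegral f (min c₁ c₂) (max R₁ R₂) = loopIntegral f (max c₁ c₂) (max R₁ R₂) :=
    loopIntegral_eq_of_le_left (h₁.trans (le_max_left _ _)) min_le_max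
      (fun ξ h1 _ h3 => hd ξ h1 (h3.imp id min_le_max.trans))
      (fun ξ h1 h2 => hdecay ξ ⟨h1, h2.le, Or.inr (min_le_max.trans h2.ge)⟩)
  rw [hheight c₁ R₁ (min_le_left _ _) (le_max_left _ _) (min_le_left _ _) (le_max_left _ _) h₁,
    hheight c₂ R₂ (min_le_right _ _) (le_max_right _ _) (min_le_right _ _) (le_max_right _ _) h₂]
  rcases le_total c₁ c₂ with h | h
  · simpa [h] using hleft
  · simpa [h] using hleft.symm

/-- The loop of `loopIntegral f c R`, parametrised by arc length. -/
noncomputable def loopPath (c R s : ℝ) : ℂ :=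
  ((c + max 0 (|s| - R) : ℝ) : ℂ) + ((max (-R) (min s R) : ℝ) : ℂ) * Complex.I

open Classical in
/-- The unit tangent vector of `loopPath c R`. -/
noncomputable def loopTangent (R s : ℝ) : ℂ :=
  if s ≤ -R then -1 else if s ≤ R then Complex.I else 1

lemma continuous_loopPath (c R : ℝ) : Continuous (loopPath c R) := by
  unfold loopPath; fun_prop

@[simp] lemma loopPath_re (c R s : ℝ) : (loopPath c R s).re = c + max 0 (|s| - R) := by
  simp [loopPath]

@[simp] lemma loopPath_im (c R s : ℝ) : (loopPath c R s).im = max (-R) (min s R) := by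
  simp [loopPath]

lemma le_loopPath_re (c R s : ℝ) : c ≤ (loopPath c R s).re := by simp

lemma loopPath_mem_loopStrip {R : ℝ} (hR : 0 ≤ R) (c s : ℝ) : loopPath c R s ∈ loopStrip c R R := by
  refine ⟨le_loopPath_re c R s, ?_, ?_⟩
  · rw [loopPath_im, abs_le]
    exact ⟨le_max_left _ _, max_le (by linarith) (min_le_right _ _)⟩
  · simp only [loopPath_re, loopPath_im]
    rcases le_total |s| R with h | h
    · left; rw [max_eq_left (by linarith)]; simp
    · right
      rcases le_total 0 s with h0 | h0
      · rw [abs_of_nonneg h0] at h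
        rw [min_eq_right h, max_eq_right (by linarith), abs_of_nonneg hR]
      · rw [abs_of_nonpos h0] at h
        rw [min_eq_left (by linarith), max_eq_left (by linarith), abs_neg, abs_of_nonneg hR]

lemma norm_loopTangent (R s : ℝ) : ‖loopTangent R s‖ = 1 := by
  unfold loopTangent; split_ifs <;> simp

lemma measurable_loopTangent (R : ℝ) : Measurable (loopTangent R) :=
  Measurable.ite measurableSet_Iic measurable_const
    (Measurable.ite measurableSet_Iic measurable_const measurable_const)

lemma setIntegral_Ioi_comp_add_sub (g : ℝ → ℂ) (c R : ℝ) :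
    ∫ s in Ioi R, g (c + (s - R)) = ∫ s in Ioi c, g s := by
  have := (measurePreserving_add_right volume (c - R)).setIntegral_preimage_emb
    (MeasurableEquiv.addRight (c - R)).measurableEmbedding g (Ioi c)
  rw [← this]
  have hpre : (fun x : ℝ => x + (c - R)) ⁻¹' Ioi c = Ioi R := by
    ext x; simp
  rw [hpre]
  refine setIntegral_congr_fun measurableSet_Ioi fun s _ => congrArg g ?_
  ring

/-- The loop integral as a single integral over the real line. Integrability is needed:
if only some of the three pieces of `loopIntegral` converge, their sum need not be the junk value
`0` of the right-hand side. -/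
lemma loopIntegral_eq_integral_loopPath {f : ℂ → ℂ} {c R : ℝ} (hR : 0 ≤ R)
    (hint : Integrable fun s : ℝ => f (loopPath c R s) * loopTangent R s) :
    loopIntegral f c R = ∫ s : ℝ, f (loopPath c R s) * loopTangent R s := by
  have e1 : ∫ s in Iic (-R), f (loopPath c R s) * loopTangent R s =
      -∫ s in Ioi c, f (s - R * Complex.I) := by
    rw [← setIntegral_Ioi_comp_add_sub (fun s => f (s - R * Complex.I)) c R,
      ← integral_comp_neg_Ioi, ← integral_neg]
    refine setIntegral_congr_fun measurableSet_Ioi fun s hs => ?_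
    have hs' : R < s := hs
    simp only [loopTangent, loopPath]
    rw [if_pos (by linarith), abs_neg, abs_of_pos (by linarith), max_eq_right (by linarith),
      min_eq_left (by linarith), max_eq_left (by linarith)]
    simp [sub_eq_add_neg]
  have e2 : ∫ s in (-R)..R, f (loopPath c R s) * loopTangent R s =
      Complex.I * ∫ y in (-R)..R, f (c + y * Complex.I) := by
    rw [← intervalIntegral.integral_const_mul, intervalIntegral.integral_of_le (by linarith),
      intervalIntegral.integral_of_le (by linarith)]
    refine setIntegral_congr_fun measurableSet_Ioc fun s hs => ?_
    have habs : |s| ≤ R := abs_le.2 ⟨hs.1.le, hs.2⟩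
    simp only [loopTangent, loopPath]
    rw [if_neg (not_le.2 hs.1), if_pos hs.2, max_eq_left (by linarith), min_eq_left hs.2,
      max_eq_right hs.1.le, add_zero, mul_comm]
  have e3 : ∫ s in Ioi R, f (loopPath c R s) * loopTangent R s =
      ∫ s in Ioi c, f (s + R * Complex.I) := by
    rw [← setIntegral_Ioi_comp_add_sub (fun s => f (s + R * Complex.I)) c R]
    refine setIntegral_congr_fun measurableSet_Ioi fun s hs => ?_
    have hs' : R < s := hs
    simp only [loopTangent, loopPath]
    rw [if_neg (by linarith), if_neg (by linarith), abs_of_pos (by linarith),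
      max_eq_right (by linarith), min_eq_right (by linarith), max_eq_right (by linarith), mul_one]
  have h1 := intervalIntegral.integral_Iic_add_Ioi (b := R) hint.integrableOn hint.integrableOn
  have h2 := intervalIntegral.integral_Iic_sub_Iic (a := -R) (b := R) hint.integrableOn
    hint.integrableOn
  unfold loopIntegral
  rw [← h1, ← e1, ← e2, ← e3, ← h2]
  ring

/-! ### Superpositions of powers -/

/-- Measurable functions on `ℝ` that decay faster than every exponential. -/
structure IsRapid (G : ℝ → ℂ) : Prop where
  measurable : Measurable G
  decay : ∀ ρ : ℝ, ∃ C, ∀ s, ‖G s‖ ≤ C * Real.exp (-(ρ * |s|))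

lemma IsRapid.mul {G F : ℝ → ℂ} (hG : IsRapid G) (hF : Measurable F) {κ C : ℝ}
    (hbd : ∀ s, ‖F s‖ ≤ C * Real.exp (κ * |s|)) : IsRapid fun s => G s * F s := by
  refine ⟨hG.measurable.mul hF, fun ρ => ?_⟩
  obtain ⟨C', hC'⟩ := hG.decay (ρ + κ)
  refine ⟨C' * C, fun s => ?_⟩
  rw [norm_mul]
  calc _ ≤ (C' * Real.exp (-((ρ + κ) * |s|))) * (C * Real.exp (κ * |s|)) :=
        mul_le_mul (hC' s) (hbd s) (norm_nonneg _) ((norm_nonneg _).trans (hC' s))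
    _ = C' * C * (Real.exp (-((ρ + κ) * |s|)) * Real.exp (κ * |s|)) := by ring
    _ = _ := by rw [← Real.exp_add]; congr 2; ring

lemma integrable_exp_neg_abs : Integrable fun s : ℝ => Real.exp (-|s|) := by
  rw [← integrableOn_univ, ← Iic_union_Ioi (a := (0 : ℝ)), integrableOn_union]
  refine ⟨(integrableOn_exp_Iic 0).congr_fun (fun s hs => ?_) measurableSet_Iic,
    (integrableOn_exp_neg_Ioi 0).congr_fun (fun s hs => ?_) measurableSet_Ioi⟩
  · rw [abs_of_nonpos hs, neg_neg]
  · rw [abs_of_pos hs]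

lemma IsRapid.integrable {G : ℝ → ℂ} (hG : IsRapid G) : Integrable G := by
  obtain ⟨C, hC⟩ := hG.decay 1
  exact (integrable_exp_neg_abs.const_mul C).mono' hG.measurable.aestronglyMeasurable
    (Eventually.of_forall fun s => by simpa using hC s)

/-- Continuous families of exponents whose real part is at least `δ` and grows at most linearly. -/
structure IsExponent (δ : ℝ) (e : ℝ → ℂ) : Prop where
  continuous : Continuous e
  lower : ∀ s, δ ≤ (e s).re
  upper : ∃ A B : ℝ, ∀ s, (e s).re ≤ A + B * |s|

/-- The superposition `∫ G(s) t^(e(s) - 1) ds` of powers of `t`. -/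
noncomputable def powerMix (G e : ℝ → ℂ) (t : ℝ) : ℂ := ∫ s, G s * (t : ℂ) ^ (e s - 1)

/-- On `(0, T]` the integrand of a superposition is dominated by `t^(δ - 1)` times an integrable
function that does not depend on `t`. -/
lemma exists_integrable_dominating {G e : ℝ → ℂ} {δ : ℝ} (hG : IsRapid G) (he : IsExponent δ e)
    (T : ℝ) : ∃ H : ℝ → ℝ, Integrable H ∧ (∀ s, 0 ≤ H s) ∧ ∀ t ∈ Ioc 0 T, ∀ s,
      ‖G s * (t : ℂ) ^ (e s - 1)‖ ≤ t ^ (δ - 1) * H s := by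
  obtain ⟨A, B, hAB⟩ := he.upper
  set T' := max T 1
  have hT' : 1 ≤ T' := le_max_right _ _
  set ℓ := Real.log T'
  have hℓ : 0 ≤ ℓ := Real.log_nonneg hT'
  obtain ⟨C, hC⟩ := hG.decay (ℓ * B + 1)
  have hC0 : 0 ≤ C := by
    have := (norm_nonneg _).trans (hC 0)
    simpa using this
  refine ⟨fun s => C * Real.exp (ℓ * (A - δ)) * Real.exp (-|s|),
    integrable_exp_neg_abs.const_mul _, fun s => by positivity, fun t ht s => ?_⟩
  have hpow : t ^ ((e s).re - 1) ≤ t ^ (δ - 1) * Real.exp (ℓ * (A + B * |s| - δ)) := by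
    have h1 : t ^ ((e s).re - 1) = t ^ (δ - 1) * t ^ ((e s).re - δ) := by
      rw [← Real.rpow_add ht.1]; congr 1; ring
    rw [h1]
    refine mul_le_mul_of_nonneg_left ?_ (Real.rpow_nonneg ht.1.le _)
    calc t ^ ((e s).re - δ) ≤ T' ^ ((e s).re - δ) :=
          Real.rpow_le_rpow ht.1.le (ht.2.trans (le_max_left _ _)) (by linarith [he.lower s])
      _ ≤ T' ^ (A + B * |s| - δ) :=
          Real.rpow_le_rpow_of_exponent_le hT' (by linarith [hAB s])
      _ = _ := Real.rpow_def_of_pos (by linarith) _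
  rw [norm_mul, Complex.norm_cpow_eq_rpow_re_of_pos ht.1, Complex.sub_re, Complex.one_re]
  calc _ ≤ (C * Real.exp (-((ℓ * B + 1) * |s|))) *
        (t ^ (δ - 1) * Real.exp (ℓ * (A + B * |s| - δ))) :=
        mul_le_mul (hC s) hpow (Real.rpow_nonneg ht.1.le _) (by positivity)
    _ = t ^ (δ - 1) * (C * (Real.exp (-((ℓ * B + 1) * |s|)) *
        Real.exp (ℓ * (A + B * |s| - δ)))) := by ring
    _ = _ := by
      beta_reduce
      rw [mul_assoc C, ← Real.exp_add, ← Real.exp_add]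
      congr 3; ring

lemma measurable_powerMix_integrand {G e : ℝ → ℂ} {δ : ℝ} (hG : IsRapid G)
    (he : IsExponent δ e) : Measurable fun p : ℝ × ℝ => G p.2 * (p.1 : ℂ) ^ (e p.2 - 1) := by
  have h1 := hG.measurable
  have h2 := he.continuous.measurable
  fun_prop

lemma exists_norm_powerMix_le {G e : ℝ → ℂ} {δ : ℝ} (hG : IsRapid G) (he : IsExponent δ e)
    (T : ℝ) : ∃ C, 0 ≤ C ∧ ∀ t ∈ Ioc 0 T, ‖powerMix G e t‖ ≤ C * t ^ (δ - 1) := by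
  obtain ⟨H, hH, h0, hb⟩ := exists_integrable_dominating hG he T
  refine ⟨∫ s, H s, integral_nonneg h0, fun t ht => ?_⟩
  rw [mul_comm, ← integral_const_mul]
  exact norm_integral_le_of_norm_le (hH.const_mul _) (Eventually.of_forall fun s => hb t ht s)

lemma continuousOn_powerMix {G e : ℝ → ℂ} {δ : ℝ} (hG : IsRapid G) (he : IsExponent δ e) :
    ContinuousOn (powerMix G e) (Ioi 0) := by
  intro t ht
  refine ContinuousAt.continuousWithinAt ?_
  have ht' : (0 : ℝ) < t := ht
  obtain ⟨H, hH, h0, hb⟩ := exists_integrable_dominating hG he (t + 1)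
  refine continuousAt_of_dominated (bound := fun s => (t ^ (δ - 1) + 1) * H s)
    (Eventually.of_forall fun u => ((measurable_powerMix_integrand hG he).comp
      measurable_prodMk_left).aestronglyMeasurable) ?_ (hH.const_mul _) ?_
  · have h1 : ∀ᶠ u in 𝓝 t, u ^ (δ - 1) ≤ t ^ (δ - 1) + 1 :=
      (Real.continuousAt_rpow_const t (δ - 1) (Or.inl ht'.ne')).eventually
        (Iic_mem_nhds (by simp))
    filter_upwards [h1, Ioc_mem_nhds ht' (by linarith : t < t + 1)] with u hu hu'
    exact Eventually.of_forall fun s =>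
      (hb u hu' s).trans (mul_le_mul_of_nonneg_right hu (h0 s))
  · refine Eventually.of_forall fun s => continuousAt_const.mul ?_
    exact (Complex.continuousAt_ofReal_cpow_const t _ (Or.inr ht'.ne'))

/-- The real Beta integral over `(0, t)`; `K` is the value `B(p, q)`. -/
lemma exists_integral_rpow_mul_rpow {p q : ℝ} (hp : 0 < p) (hq : 0 < q) :
    ∃ K, ∀ t : ℝ, 0 < t →
      IntervalIntegrable (fun τ => (t - τ) ^ (p - 1) * τ ^ (q - 1)) volume 0 t ∧
      ∫ τ in 0..t, (t - τ) ^ (p - 1) * τ ^ (q - 1) = K * t ^ (p + q - 1) := by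
  set f : ℝ → ℝ := fun τ => (1 - τ) ^ (p - 1) * τ ^ (q - 1)
  have hf : IntervalIntegrable f volume 0 1 := by
    have h := (Complex.betaIntegral_convergent (u := q) (v := p) (by simpa) (by simpa)).norm
    refine h.congr_ae ?_
    rw [uIoc_of_le zero_le_one, ← restrict_Ioo_eq_restrict_Ioc]
    refine (ae_restrict_mem measurableSet_Ioo).mono fun x hx => ?_
    have h1 : (1 : ℂ) - x = ((1 - x : ℝ) : ℂ) := by push_cast; ring
    simp only [f]
    rw [h1, norm_mul, Complex.norm_cpow_eq_rpow_re_of_pos hx.1,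
      Complex.norm_cpow_eq_rpow_re_of_pos (by linarith [hx.2])]
    simp [mul_comm]
  refine ⟨∫ τ in 0..1, f τ, fun t ht => ?_⟩
  have hscale : ∀ τ ∈ uIcc 0 t, (t - τ) ^ (p - 1) * τ ^ (q - 1) =
      t ^ (p + q - 2) * f (τ / t) := by
    intro τ hτ
    rw [uIcc_of_le ht.le] at hτ
    have h1 : t - τ = t * (1 - τ / t) := by field_simp
    have h2 : τ = t * (τ / t) := by field_simp
    have h3 : 0 ≤ 1 - τ / t := by rw [sub_nonneg, div_le_one ht]; exact hτ.2
    have h4 : 0 ≤ τ / t := div_nonneg hτ.1 ht.le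
    have h5 : t ^ (p + q - 2) = t ^ (p - 1) * t ^ (q - 1) := by
      rw [← Real.rpow_add ht]; congr 1; ring
    rw [h1, Real.mul_rpow ht.le h3, h5]
    nth_rewrite 2 [h2]
    rw [Real.mul_rpow ht.le h4]
    simp only [f]
    ring
  have hint : IntervalIntegrable (fun τ => t ^ (p + q - 2) * f (τ / t)) volume 0 t := by
    have h := (hf.comp_mul_right (c := t⁻¹)).const_mul (t ^ (p + q - 2))
    simpa [div_eq_mul_inv] using h
  refine ⟨hint.congr fun τ hτ => (hscale τ (uIoc_subset_uIcc hτ)).symm, ?_⟩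
  rw [intervalIntegral.integral_congr hscale, intervalIntegral.integral_const_mul,
    intervalIntegral.integral_comp_div _ ht.ne']
  simp only [zero_div, div_self ht.ne', smul_eq_mul]
  have h6 : t ^ (p + q - 1) = t ^ (p + q - 2) * t := by
    rw [← Real.rpow_add_one ht.ne']; congr 1; ring
  rw [h6]; ring

/-- Fractional integration of a superposition of powers, by Fubini and the Beta integral. -/
lemma integral_cpow_mul_powerMix {G e : ℝ → ℂ} {δ : ℝ} (hδ : 0 < δ) (hG : IsRapid G)
    (he : IsExponent δ e) {l : ℂ} (hl : 0 < l.re) {t : ℝ} (ht : 0 < t) :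
    ∫ τ in 0..t, ((t - τ : ℝ) : ℂ) ^ (l - 1) * powerMix G e τ =
      powerMix (fun s => G s * (Complex.Gamma l * (Complex.Gamma (e s) / Complex.Gamma (e s + l))))
        (fun s => e s + l) t := by
  obtain ⟨H, hH, h0, hb⟩ := exists_integrable_dominating hG he t
  obtain ⟨K, hK⟩ := exists_integral_rpow_mul_rpow hl hδ
  have hmeas : Measurable (Function.uncurry fun τ s : ℝ =>
      ((t - τ : ℝ) : ℂ) ^ (l - 1) * (G s * (τ : ℂ) ^ (e s - 1))) := by
    have h1 := hG.measurable
    have h2 := he.continuous.measurable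
    unfold Function.uncurry
    fun_prop
  have hprod : Integrable (Function.uncurry fun τ s : ℝ =>
      ((t - τ : ℝ) : ℂ) ^ (l - 1) * (G s * (τ : ℂ) ^ (e s - 1)))
      ((volume.restrict (Ioo 0 t)).prod volume) := by
    have hdom := (((hK t ht).1.1).mono_set Ioo_subset_Ioc_self).integrable.mul_prod hH
    refine hdom.mono' hmeas.aestronglyMeasurable ?_
    have hmem : ∀ᵐ z ∂((volume.restrict (Ioo 0 t)).prod (volume : Measure ℝ)), z.1 ∈ Ioo 0 t :=
      Measure.quasiMeasurePreserving_fst.ae (ae_restrict_mem measurableSet_Ioo)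
    filter_upwards [hmem] with z hz
    simp only [Function.uncurry]
    rw [norm_mul, Complex.norm_cpow_eq_rpow_re_of_pos (by linarith [hz.2]), mul_assoc,
      Complex.sub_re, Complex.one_re]
    exact mul_le_mul_of_nonneg_left (hb z.1 ⟨hz.1, hz.2.le⟩ z.2)
      (Real.rpow_nonneg (by linarith [hz.2]) _)
  calc ∫ τ in 0..t, ((t - τ : ℝ) : ℂ) ^ (l - 1) * powerMix G e τ
      = ∫ τ in Ioo 0 t, ∫ s, ((t - τ : ℝ) : ℂ) ^ (l - 1) * (G s * (τ : ℂ) ^ (e s - 1)) := by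
        rw [intervalIntegral.integral_of_le ht.le, integral_Ioc_eq_integral_Ioo]
        refine setIntegral_congr_fun measurableSet_Ioo fun τ _ => ?_
        simp only [powerMix]
        rw [integral_const_mul]
    _ = ∫ s, ∫ τ in Ioo 0 t, ((t - τ : ℝ) : ℂ) ^ (l - 1) * (G s * (τ : ℂ) ^ (e s - 1)) :=
        integral_integral_swap hprod
    _ = _ := by
        refine integral_congr_ae (Eventually.of_forall fun s => ?_)
        have hes : 0 < (e s).re := hδ.trans_le (he.lower s)
        have hbeta := Complex.betaIntegral_scaled (e s) l ht
        have hGam := Complex.Gamma_mul_Gamma_eq_betaIntegral hes hl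
        have hne : Complex.Gamma (e s + l) ≠ 0 :=
          Complex.Gamma_ne_zero_of_re_pos (by simp; linarith)
        simp only
        rw [← integral_Ioc_eq_integral_Ioo, ← intervalIntegral.integral_of_le ht.le]
        have : ∀ τ : ℝ, ((t - τ : ℝ) : ℂ) ^ (l - 1) * (G s * (τ : ℂ) ^ (e s - 1)) =
            G s * ((τ : ℂ) ^ (e s - 1) * ((t : ℂ) - τ) ^ (l - 1)) := by
          intro τ; push_cast; ring
        simp only [this]
        rw [intervalIntegral.integral_const_mul, hbeta, mul_comm (Complex.Gamma l) _,
          div_mul_eq_mul_div, hGam]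
        field_simp

/-! ### Volterra operators with weakly singular kernels -/

/-- The Volterra operator with the difference kernel `κ(x - t)`. -/
noncomputable def volterra (a : ℝ) (κ φ : ℝ → ℂ) (x : ℝ) : ℂ := ∫ t in a..x, κ (x - t) * φ t

/-- Kernels that are continuous on `(0, ∞)` and `O(t^(δ - 1))` on `(0, T]`. -/
structure IsWeaklySingular (T δ : ℝ) (κ : ℝ → ℂ) : Prop where
  continuousOn : ContinuousOn κ (Ioi 0)
  bound : ∃ C, 0 ≤ C ∧ ∀ t ∈ Ioc 0 T, ‖κ t‖ ≤ C * t ^ (δ - 1)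

section Volterra

variable {a b x δ p q : ℝ} {κ κ₁ κ₂ φ : ℝ → ℂ}

lemma IsWeaklySingular.integrable_indicator {T : ℝ} (h : IsWeaklySingular T δ κ) (hδ : 0 < δ) :
    Integrable ((Ioo 0 T).indicator κ) := by
  rw [integrable_indicator_iff measurableSet_Ioo]
  rcases le_or_gt T 0 with hT | hT
  · simp [Ioo_eq_empty (not_lt.2 hT)]
  obtain ⟨C, -, hC⟩ := h.bound
  have h1 : IntervalIntegrable (fun t : ℝ => t ^ (δ - 1)) volume 0 T :=
    intervalIntegral.intervalIntegrable_rpow' (by linarith)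
  refine ((h1.1.mono_set Ioo_subset_Ioc_self).integrable.const_mul C).mono' ?_ ?_
  · exact (h.continuousOn.mono fun t ht => ht.1).aestronglyMeasurable measurableSet_Ioo
  · exact (ae_restrict_mem measurableSet_Ioo).mono fun t ht => hC t ⟨ht.1, ht.2.le⟩

/-- Truncating the kernel to `(0, b - a)` and `φ` to `(a, b)` turns a Volterra integral into a
convolution on the whole line. -/
lemma indicator_mul_indicator_eq (hx : x < b) (κ φ : ℝ → ℂ) :
    (fun t => (Ioo 0 (b - a)).indicator κ (x - t) * (Ioo a b).indicator φ t) =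
      (Ioo a x).indicator fun t => κ (x - t) * φ t := by
  funext t
  by_cases ht : t ∈ Ioo a x
  · rw [indicator_of_mem ht, indicator_of_mem (show x - t ∈ Ioo 0 (b - a) from
      ⟨by linarith [ht.2], by linarith [ht.1]⟩),
      indicator_of_mem (show t ∈ Ioo a b from ⟨ht.1, ht.2.trans hx⟩)]
  · rw [indicator_of_notMem ht]
    by_cases h1 : a < t
    · rw [indicator_of_notMem (fun h => ht ⟨h1, by linarith [h.1]⟩), zero_mul]
    · rw [indicator_of_notMem (s := Ioo a b) (fun h => h1 h.1), mul_zero]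

lemma intervalIntegrable_iff_integrable_indicator (hx : x ∈ Ioo a b) :
    IntervalIntegrable (fun t => κ (x - t) * φ t) volume a x ↔
      Integrable fun t => (Ioo 0 (b - a)).indicator κ (x - t) * (Ioo a b).indicator φ t := by
  rw [indicator_mul_indicator_eq hx.2, integrable_indicator_iff measurableSet_Ioo,
    intervalIntegrable_iff_integrableOn_Ioo_of_le hx.1.le]

lemma volterra_eq_integral_indicator (hx : x ∈ Ioo a b) :
    volterra a κ φ x =
      ∫ t, (Ioo 0 (b - a)).indicator κ (x - t) * (Ioo a b).indicator φ t := by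
  rw [indicator_mul_indicator_eq hx.2, integral_indicator measurableSet_Ioo, volterra,
    intervalIntegral.integral_of_le hx.1.le, integral_Ioc_eq_integral_Ioo]

lemma integrable_prod_kernel (hδ : 0 < δ) (hκ : IsWeaklySingular (b - a) δ κ)
    (hφ : IntegrableOn φ (Ioo a b)) :
    Integrable (fun z : ℝ × ℝ => (Ioo 0 (b - a)).indicator κ (z.1 - z.2) *
      (Ioo a b).indicator φ z.2) := by
  have h := ((integrable_indicator_iff measurableSet_Ioo).2 hφ).convolution_integrand
    (ContinuousLinearMap.mul ℝ ℂ) (hκ.integrable_indicator hδ) (μ := volume)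
  refine h.congr (Eventually.of_forall fun z => ?_)
  simp [mul_comm]

lemma ae_intervalIntegrable_volterra (hδ : 0 < δ) (hκ : IsWeaklySingular (b - a) δ κ)
    (hφ : IntegrableOn φ (Ioo a b)) :
    ∀ᵐ x ∂(volume.restrict (Ioo a b)),
      IntervalIntegrable (fun t => κ (x - t) * φ t) volume a x := by
  have h := (integrable_prod_kernel hδ hκ hφ).prod_right_ae
  filter_upwards [ae_restrict_of_ae h, ae_restrict_mem measurableSet_Ioo] with x hx hx'
  exact (intervalIntegrable_iff_integrable_indicator hx').2 hx

lemma integrableOn_volterra (hδ : 0 < δ) (hκ : IsWeaklySingular (b - a) δ κ)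
    (hφ : IntegrableOn φ (Ioo a b)) : IntegrableOn (volterra a κ φ) (Ioo a b) := by
  have h := (integrable_prod_kernel hδ hκ hφ).integral_prod_left
  refine h.integrableOn.congr_fun (fun x hx => ?_) measurableSet_Ioo
  exact (volterra_eq_integral_indicator hx).symm

/-- The composition of two kernels whose orders of singularity add up to at least `1` is bounded. -/
lemma integrable_comp_kernel (hp : 0 < p) (hq : 0 < q) (hpq : 1 ≤ p + q) {T : ℝ} (hT : 0 < T)
    (h₁ : IsWeaklySingular T p κ₁) (h₂ : IsWeaklySingular T q κ₂) :
    ∃ M, ∀ u, u < T →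
      Integrable (fun v => (Ioo 0 T).indicator κ₁ (u - v) * (Ioo 0 T).indicator κ₂ v) ∧
      ∫ v, ‖(Ioo 0 T).indicator κ₁ (u - v) * (Ioo 0 T).indicator κ₂ v‖ ≤ M := by
  obtain ⟨C₁, hC₁, hb₁⟩ := h₁.bound
  obtain ⟨C₂, hC₂, hb₂⟩ := h₂.bound
  obtain ⟨K, hK⟩ := exists_integral_rpow_mul_rpow hp hq
  refine ⟨C₁ * C₂ * (|K| * T ^ (p + q - 1)), fun u hu => ?_⟩
  have hfun : (fun v => (Ioo 0 T).indicator κ₁ (u - v) * (Ioo 0 T).indicator κ₂ v) =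
      (Ioo 0 u).indicator fun v => κ₁ (u - v) * κ₂ v := by
    simpa using indicator_mul_indicator_eq (a := 0) hu κ₁ κ₂
  have hnorm : (fun v => ‖(Ioo 0 T).indicator κ₁ (u - v) * (Ioo 0 T).indicator κ₂ v‖) =
      (Ioo 0 u).indicator fun v => ‖κ₁ (u - v) * κ₂ v‖ := by
    funext v
    rw [congrFun hfun v, norm_indicator_eq_indicator_norm]
  rw [hnorm, hfun, integrable_indicator_iff measurableSet_Ioo, integral_indicator measurableSet_Ioo]
  rcases le_or_gt u 0 with hu0 | hu0
  · rw [Ioo_eq_empty (not_lt.2 hu0)]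
    exact ⟨by simp, by simp; positivity⟩
  obtain ⟨hI, hval⟩ := hK u hu0
  have hdom : IntegrableOn (fun v => C₁ * C₂ * ((u - v) ^ (p - 1) * v ^ (q - 1))) (Ioo 0 u) :=
    ((hI.1.mono_set Ioo_subset_Ioc_self).integrable.const_mul _)
  have hle : ∀ v ∈ Ioo 0 u, ‖κ₁ (u - v) * κ₂ v‖ ≤ C₁ * C₂ * ((u - v) ^ (p - 1) * v ^ (q - 1)) := by
    intro v hv
    rw [norm_mul]
    calc _ ≤ (C₁ * (u - v) ^ (p - 1)) * (C₂ * v ^ (q - 1)) :=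
          mul_le_mul (hb₁ _ ⟨by linarith [hv.2], by linarith [hv.1]⟩)
            (hb₂ _ ⟨hv.1, by linarith [hv.2]⟩) (norm_nonneg _)
            (mul_nonneg hC₁ (Real.rpow_nonneg (by linarith [hv.2]) _))
      _ = _ := by ring
  have hint : IntegrableOn (fun v => κ₁ (u - v) * κ₂ v) (Ioo 0 u) := by
    refine hdom.mono' (ContinuousOn.aestronglyMeasurable (ContinuousOn.mul ?_ ?_)
      measurableSet_Ioo) ((ae_restrict_mem measurableSet_Ioo).mono hle)
    · exact h₁.continuousOn.comp (by fun_prop) fun v hv => by simpa using hv.2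
    · exact h₂.continuousOn.mono fun v hv => hv.1
  refine ⟨hint, ?_⟩
  calc _ ≤ ∫ v in Ioo 0 u, C₁ * C₂ * ((u - v) ^ (p - 1) * v ^ (q - 1)) :=
        setIntegral_mono_on hint.norm hdom measurableSet_Ioo hle
    _ = C₁ * C₂ * (K * u ^ (p + q - 1)) := by
        rw [integral_const_mul, ← hval, intervalIntegral.integral_of_le hu0.le,
          integral_Ioc_eq_integral_Ioo]
    _ ≤ _ := by
        have h3 : u ^ (p + q - 1) ≤ T ^ (p + q - 1) :=
          Real.rpow_le_rpow hu0.le hu.le (by linarith)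
        have h4 : 0 ≤ u ^ (p + q - 1) := Real.rpow_nonneg hu0.le _
        refine mul_le_mul_of_nonneg_left ?_ (mul_nonneg hC₁ hC₂)
        exact mul_le_mul (le_abs_self K) h3 h4 (abs_nonneg K)

/-- The double integral of a composition of two Volterra operators converges absolutely: the inner
integral over `t` of the two kernels is bounded, so that the outer one is dominated by `|φ|`. -/
lemma integrable_triple_kernel (hp : 0 < p) (hq : 0 < q) (hpq : 1 ≤ p + q)
    (h₁ : IsWeaklySingular (b - a) p κ₁) (h₂ : IsWeaklySingular (b - a) q κ₂)
    (hφ : IntegrableOn φ (Ioo a b)) (hx : x ∈ Ioo a b) :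
    Integrable (fun z : ℝ × ℝ => (Ioo 0 (b - a)).indicator κ₁ (x - z.1) *
      ((Ioo 0 (b - a)).indicator κ₂ (z.1 - z.2) * (Ioo a b).indicator φ z.2)) := by
  have hk := (integrable_indicator_iff measurableSet_Ioo).2 hφ
  have hf := h₁.integrable_indicator hp
  have hmeas : AEStronglyMeasurable (fun z : ℝ × ℝ => (Ioo 0 (b - a)).indicator κ₁ (x - z.1) *
      ((Ioo 0 (b - a)).indicator κ₂ (z.1 - z.2) * (Ioo a b).indicator φ z.2))
      (volume.prod volume) :=
    (hf.comp_sub_left x).aestronglyMeasurable.comp_fst.mul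
      (integrable_prod_kernel hq h₂ hφ).aestronglyMeasurable
  obtain ⟨M, hM⟩ := integrable_comp_kernel hp hq hpq (by linarith [hx.1, hx.2]) h₁ h₂
  have hslice : ∀ τ, Integrable (fun t => (Ioo 0 (b - a)).indicator κ₁ (x - t) *
      ((Ioo 0 (b - a)).indicator κ₂ (t - τ) * (Ioo a b).indicator φ τ)) ∧
      ∫ t, ‖(Ioo 0 (b - a)).indicator κ₁ (x - t) *
        ((Ioo 0 (b - a)).indicator κ₂ (t - τ) * (Ioo a b).indicator φ τ)‖ ≤
      M * ‖(Ioo a b).indicator φ τ‖ := by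
    intro τ
    by_cases hτ : τ ∈ Ioo a b
    · obtain ⟨hi, hle⟩ := hM (x - τ) (by linarith [hτ.1, hx.2])
      have hi' := (hi.comp_sub_right τ).mul_const ((Ioo a b).indicator φ τ)
      have heq : (fun t => (Ioo 0 (b - a)).indicator κ₁ (x - t) *
          ((Ioo 0 (b - a)).indicator κ₂ (t - τ) * (Ioo a b).indicator φ τ)) = fun t =>
          (Ioo 0 (b - a)).indicator κ₁ (x - τ - (t - τ)) *
            (Ioo 0 (b - a)).indicator κ₂ (t - τ) * (Ioo a b).indicator φ τ := by
        funext t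
        rw [sub_sub_sub_cancel_right, mul_assoc]
      refine ⟨heq ▸ hi', ?_⟩
      have hn := integral_sub_right_eq_self (μ := volume) (fun v =>
        ‖(Ioo 0 (b - a)).indicator κ₁ (x - τ - v) * (Ioo 0 (b - a)).indicator κ₂ v‖) τ
      calc _ = ∫ t, ‖(Ioo 0 (b - a)).indicator κ₁ (x - τ - (t - τ)) *
            (Ioo 0 (b - a)).indicator κ₂ (t - τ)‖ * ‖(Ioo a b).indicator φ τ‖ := by
            refine integral_congr_ae (Eventually.of_forall fun t => ?_)
            beta_reduce
            rw [congrFun heq t, norm_mul]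
        _ ≤ _ := by
            rw [integral_mul_const, hn]
            exact mul_le_mul_of_nonneg_right hle (norm_nonneg _)
    · simp [indicator_of_notMem hτ]
  refine (integrable_prod_iff' hmeas).2 ⟨Eventually.of_forall fun τ => (hslice τ).1, ?_⟩
  refine (hk.norm.const_mul M).mono' hmeas.norm.prod_swap.integral_prod_right'
    (Eventually.of_forall fun τ => ?_)
  rw [Real.norm_of_nonneg (integral_nonneg fun _ => norm_nonneg _)]
  exact (hslice τ).2

/-- Composition of two Volterra operators, at every point: the composed kernel is
`volterra 0 κ₁ κ₂`, the convolution of the two kernels on `(0, ∞)`. -/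
lemma volterra_volterra (hp : 0 < p) (hq : 0 < q) (hpq : 1 ≤ p + q)
    (h₁ : IsWeaklySingular (b - a) p κ₁) (h₂ : IsWeaklySingular (b - a) q κ₂)
    (hφ : IntegrableOn φ (Ioo a b)) (hx : x ∈ Ioo a b) :
    IntervalIntegrable (fun t => κ₁ (x - t) * volterra a κ₂ φ t) volume a x ∧
      volterra a κ₁ (volterra a κ₂ φ) x = volterra a (volterra 0 κ₁ κ₂) φ x := by
  have hF := integrable_triple_kernel hp hq hpq h₁ h₂ hφ hx
  have hinner : (fun t => ∫ τ, (Ioo 0 (b - a)).indicator κ₁ (x - t) *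
      ((Ioo 0 (b - a)).indicator κ₂ (t - τ) * (Ioo a b).indicator φ τ)) =
      (Ioo a x).indicator fun t => κ₁ (x - t) * volterra a κ₂ φ t := by
    funext t
    rw [integral_const_mul]
    by_cases ht : t ∈ Ioo a x
    · rw [indicator_of_mem ht, indicator_of_mem (show x - t ∈ Ioo 0 (b - a) from
        ⟨by linarith [ht.2], by linarith [ht.1, hx.2]⟩),
        ← volterra_eq_integral_indicator ⟨ht.1, ht.2.trans hx.2⟩]
    · rw [indicator_of_notMem ht]
      by_cases h1 : a < t
      · rw [indicator_of_notMem (fun h => ht ⟨h1, by linarith [h.1]⟩), zero_mul]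
      · have : t < b := by linarith [hx.1, hx.2, not_lt.1 h1]
        rw [indicator_mul_indicator_eq this, Ioo_eq_empty h1]
        simp
  have houter : ∀ τ, ∫ t, (Ioo 0 (b - a)).indicator κ₁ (x - t) *
      ((Ioo 0 (b - a)).indicator κ₂ (t - τ) * (Ioo a b).indicator φ τ) =
      (Ioo a x).indicator (fun τ => volterra 0 κ₁ κ₂ (x - τ) * φ τ) τ := by
    intro τ
    by_cases hτ : τ ∈ Ioo a b
    · have h3 := integral_sub_right_eq_self (μ := volume) (fun v =>
        (Ioo 0 (b - a)).indicator κ₁ (x - τ - v) * (Ioo 0 (b - a)).indicator κ₂ v) τ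
      have h4 : ∀ t, (Ioo 0 (b - a)).indicator κ₁ (x - t) *
          ((Ioo 0 (b - a)).indicator κ₂ (t - τ) * (Ioo a b).indicator φ τ) =
          (Ioo 0 (b - a)).indicator κ₁ (x - τ - (t - τ)) *
            (Ioo 0 (b - a)).indicator κ₂ (t - τ) * (Ioo a b).indicator φ τ := by
        intro t
        rw [sub_sub_sub_cancel_right, mul_assoc]
      simp_rw [h4]
      rw [integral_mul_const, h3, indicator_of_mem hτ]
      have h5 := indicator_mul_indicator_eq (a := 0) (b := b - a) (x := x - τ)
        (by linarith [hτ.1, hx.2]) κ₁ κ₂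
      rw [sub_zero] at h5
      rw [h5]
      by_cases hxτ : τ < x
      · rw [indicator_of_mem (show τ ∈ Ioo a x from ⟨hτ.1, hxτ⟩),
          integral_indicator measurableSet_Ioo, volterra,
          intervalIntegral.integral_of_le (by linarith), integral_Ioc_eq_integral_Ioo]
      · rw [indicator_of_notMem (fun h => hxτ h.2), Ioo_eq_empty (by linarith)]
        simp
    · rw [indicator_of_notMem (s := Ioo a x) (fun h => hτ ⟨h.1, h.2.trans hx.2⟩)]
      simp [indicator_of_notMem hτ]
  have hint := hF.integral_prod_left
  simp only [hinner] at hint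
  refine ⟨?_, ?_⟩
  · rw [intervalIntegrable_iff_integrableOn_Ioo_of_le hx.1.le]
    exact (integrable_indicator_iff measurableSet_Ioo).1 hint
  · have hswap := integral_integral_swap (f := fun t τ => (Ioo 0 (b - a)).indicator κ₁ (x - t) *
      ((Ioo 0 (b - a)).indicator κ₂ (t - τ) * (Ioo a b).indicator φ τ)) hF
    simp only [hinner, houter] at hswap
    rw [integral_indicator measurableSet_Ioo, integral_indicator measurableSet_Ioo] at hswap
    rw [volterra, volterra, intervalIntegral.integral_of_le hx.1.le,
      intervalIntegral.integral_of_le hx.1.le, integral_Ioc_eq_integral_Ioo,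
      integral_Ioc_eq_integral_Ioo, hswap]

lemma intervalIntegrable_volterra_of_continuousOn (hδ : 0 < δ)
    (hκ : IsWeaklySingular (b - a) δ κ) (hφ : IntegrableOn φ (Ioo a b))
    (hc : ContinuousOn φ (Ioo a b)) (hx : x ∈ Ioo a b) :
    IntervalIntegrable (fun t => κ (x - t) * φ t) volume a x := by
  obtain ⟨m, ham, hmx⟩ := exists_between hx.1
  refine IntervalIntegrable.trans (b := m) ?_ ?_
  · have h1 : IntervalIntegrable φ volume a m := by
      rw [intervalIntegrable_iff_integrableOn_Ioo_of_le ham.le]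
      exact hφ.mono_set (Ioo_subset_Ioo_right (by linarith [hx.2]))
    refine h1.continuousOn_mul (hκ.continuousOn.comp (by fun_prop) fun t ht => ?_)
    rw [uIcc_of_le ham.le] at ht
    exact mem_Ioi.2 (by linarith [ht.2])
  · have h1 : IntervalIntegrable κ volume 0 (x - m) := by
      rw [intervalIntegrable_iff_integrableOn_Ioo_of_le (by linarith)]
      exact ((integrable_indicator_iff measurableSet_Ioo).1 (hκ.integrable_indicator hδ)).mono_set
        (Ioo_subset_Ioo_right (by linarith [hx.2]))
    have h2 := (h1.comp_sub_left x).symm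
    rw [sub_sub_cancel, sub_zero] at h2
    refine h2.mul_continuousOn (hc.mono fun t ht => ?_)
    rw [uIcc_of_le hmx.le] at ht
    exact ⟨by linarith [ht.1], by linarith [ht.2, hx.2]⟩

/-- If `φ` is continuous, so is its image under a weakly singular Volterra operator: the part of
the integral away from the diagonal depends continuously on `x` through the kernel, the part near
the diagonal through `φ`. -/
lemma continuousOn_volterra (hδ : 0 < δ) (hκ : IsWeaklySingular (b - a) δ κ)
    (hφ : IntegrableOn φ (Ioo a b)) (hc : ContinuousOn φ (Ioo a b)) :
    ContinuousOn (volterra a κ φ) (Ioo a b) := by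
  intro x hx
  refine ContinuousAt.continuousWithinAt ?_
  obtain ⟨m, ham, hmx⟩ := exists_between hx.1
  obtain ⟨m', hmm', hm'x⟩ := exists_between hmx
  obtain ⟨d, hxd, hdb⟩ := exists_between hx.2
  have hnhds : Ioo m' d ∈ 𝓝 x := Ioo_mem_nhds hm'x hxd
  have hφam : IntegrableOn φ (Ioo a m) :=
    hφ.mono_set (Ioo_subset_Ioo_right (by linarith [hx.2]))
  have hpos : ∀ y ∈ Ioo m' d, ∀ t ∈ Ioo a m, y - t ∈ Icc (m' - m) (d - a) := fun y hy t ht =>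
    ⟨by linarith [hy.1, ht.2], by linarith [hy.2, ht.1]⟩
  have hfar : ContinuousAt (fun y => ∫ t in Ioo a m, κ (y - t) * φ t) x := by
    obtain ⟨M, hM⟩ := isCompact_Icc.exists_bound_of_continuousOn
      (hκ.continuousOn.mono (show Icc (m' - m) (d - a) ⊆ Ioi 0 from
        fun u hu => mem_Ioi.2 (by linarith [hu.1])))
    refine continuousAt_of_dominated (bound := fun t => M * ‖φ t‖) ?_ ?_ (hφam.norm.const_mul M) ?_
    · filter_upwards [hnhds] with y hy
      refine AEStronglyMeasurable.mul (ContinuousOn.aestronglyMeasurable ?_ measurableSet_Ioo)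
        hφam.aestronglyMeasurable
      exact hκ.continuousOn.comp (by fun_prop) fun t ht =>
        mem_Ioi.2 (by linarith [(hpos y hy t ht).1])
    · filter_upwards [hnhds] with y hy
      filter_upwards [ae_restrict_mem measurableSet_Ioo] with t ht
      rw [norm_mul]
      exact mul_le_mul_of_nonneg_right (hM _ (hpos y hy t ht)) (norm_nonneg _)
    · filter_upwards [ae_restrict_mem measurableSet_Ioo] with t ht
      refine ContinuousAt.mul ?_ continuousAt_const
      refine ContinuousAt.comp (f := fun y => y - t) (g := κ) (hκ.continuousOn.continuousAt
        (Ioi_mem_nhds ?_)) (by fun_prop)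
      linarith [ht.2]
  have hnear : ContinuousAt
      (fun y => ∫ u, (Ioo 0 (y - m)).indicator (fun u => κ u * φ (y - u)) u) x := by
    obtain ⟨M, hM⟩ := (isCompact_Icc (a := m) (b := d)).exists_bound_of_continuousOn
      (hc.mono (fun u hu => ⟨by linarith [hu.1], by linarith [hu.2]⟩))
    have hM0 : 0 ≤ M := (norm_nonneg _).trans (hM m ⟨le_rfl, by linarith⟩)
    refine continuousAt_of_dominated
      (bound := fun u => ‖(Ioo 0 (b - a)).indicator κ u‖ * M) ?_ ?_
      ((hκ.integrable_indicator hδ).norm.mul_const M) ?_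
    · filter_upwards [hnhds] with y hy
      refine (aestronglyMeasurable_indicator_iff measurableSet_Ioo).2
        (ContinuousOn.aestronglyMeasurable ?_ measurableSet_Ioo)
      refine ContinuousOn.mul (hκ.continuousOn.mono fun u hu => hu.1)
        (hc.comp (by fun_prop) fun u hu => ?_)
      exact ⟨by linarith [hu.2], by linarith [hu.1, hy.2]⟩
    · filter_upwards [hnhds] with y hy
      refine Eventually.of_forall fun u => ?_
      by_cases hu : u ∈ Ioo 0 (y - m)
      · rw [indicator_of_mem hu, indicator_of_mem (show u ∈ Ioo 0 (b - a) from
          ⟨hu.1, by linarith [hu.2, hy.2]⟩), norm_mul]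
        exact mul_le_mul_of_nonneg_left
          (hM _ ⟨by linarith [hu.2], by linarith [hu.1, hy.2]⟩) (norm_nonneg _)
      · rw [indicator_of_notMem hu, norm_zero]
        positivity
    · have hne : ∀ᵐ u : ℝ, u ≠ x - m := Measure.ae_ne volume _
      filter_upwards [hne] with u hu
      by_cases h0 : 0 < u
      · rcases lt_or_gt_of_ne hu with h1 | h1
        · have hcu : ContinuousAt (fun y => κ u * φ (y - u)) x := by
            refine continuousAt_const.mul (ContinuousAt.comp (f := fun y => y - u) (g := φ)
              (hc.continuousAt (Ioo_mem_nhds ?_ ?_)) (by fun_prop))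
            · linarith
            · linarith [hx.2]
          refine hcu.congr ?_
          filter_upwards [Ioi_mem_nhds (show u + m < x by linarith)] with y hy
          have hy' : u + m < y := hy
          rw [indicator_of_mem (show u ∈ Ioo 0 (y - m) from ⟨h0, by linarith⟩)]
        · refine (continuousAt_const (y := (0 : ℂ))).congr ?_
          filter_upwards [Iio_mem_nhds (show x < u + m by linarith)] with y hy
          have hy' : y < u + m := hy
          rw [indicator_of_notMem (fun h => by linarith [h.2])]
      · refine (continuousAt_const (y := (0 : ℂ))).congr (Eventually.of_forall fun y => ?_)
        beta_reduce
        rw [indicator_of_notMem (fun h => h0 h.1)]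
  refine (hfar.add hnear).congr ?_
  filter_upwards [hnhds] with y hy
  have hyab : y ∈ Ioo a b := ⟨by linarith [hy.1], by linarith [hy.2]⟩
  have hint := intervalIntegrable_volterra_of_continuousOn hδ hκ hφ hc hyab
  have hmy : m ≤ y := by linarith [hy.1]
  have hsub1 : IntervalIntegrable (fun t => κ (y - t) * φ t) volume a m :=
    hint.mono_set (by
      rw [uIcc_of_le ham.le, uIcc_of_le hyab.1.le]; exact Icc_subset_Icc_right hmy)
  have hsub2 : IntervalIntegrable (fun t => κ (y - t) * φ t) volume m y :=
    hint.mono_set (by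
      rw [uIcc_of_le hmy, uIcc_of_le hyab.1.le]; exact Icc_subset_Icc_left ham.le)
  rw [Pi.add_apply, volterra, ← intervalIntegral.integral_add_adjacent_intervals hsub1 hsub2,
    intervalIntegral.integral_of_le ham.le, integral_Ioc_eq_integral_Ioo,
    integral_indicator measurableSet_Ioo, ← integral_Ioc_eq_integral_Ioo (x := (0 : ℝ)),
    ← intervalIntegral.integral_of_le (by linarith)]
  congr 1
  have h := intervalIntegral.integral_comp_sub_left (a := m) (b := y)
    (fun u => κ u * φ (y - u)) y
  simpa using h.symm

end Volterra

/-! ### Towers of primitives -/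

lemma intervalIntegral_eq_of_eq_on_Ioo {f g : ℝ → ℂ} {a x : ℝ} (hax : a ≤ x)
    (h : ∀ t ∈ Ioo a x, f t = g t) : ∫ t in a..x, f t = ∫ t in a..x, g t := by
  rw [intervalIntegral.integral_of_le hax, intervalIntegral.integral_of_le hax,
    integral_Ioc_eq_integral_Ioo, integral_Ioc_eq_integral_Ioo]
  exact setIntegral_congr_fun measurableSet_Ioo h

lemma intervalIntegrable_iff_of_eq_on_Ioo {f g : ℝ → ℂ} {a x : ℝ} (hax : a ≤ x)
    (h : ∀ t ∈ Ioo a x, f t = g t) :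
    IntervalIntegrable f volume a x ↔ IntervalIntegrable g volume a x := by
  rw [intervalIntegrable_iff_integrableOn_Ioo_of_le hax,
    intervalIntegrable_iff_integrableOn_Ioo_of_le hax]
  exact integrableOn_congr_fun h measurableSet_Ioo

lemma volterra_congr {a x : ℝ} (hax : a ≤ x) {κ κ' φ : ℝ → ℂ} (h : ∀ t, 0 < t → κ t = κ' t) :
    volterra a κ φ x = volterra a κ' φ x :=
  intervalIntegral_eq_of_eq_on_Ioo hax fun t ht => by rw [h (x - t) (by linarith [ht.2])]

lemma contDiffOn_of_hasDerivAt_chain {U : Set ℝ} (hU : IsOpen U) {W : ℕ → ℝ → ℂ}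
    (hcont : ContinuousOn (W 1) U)
    (hW : ∀ j, ∀ x ∈ U, HasDerivAt (W (j + 2)) (W (j + 1) x) x) (m : ℕ) {f : ℝ → ℂ}
    (hf : EqOn f (W (m + 1)) U) :
    ContDiffOn ℝ m f U ∧ EqOn (iteratedDeriv m f) (W 1) U := by
  induction m generalizing f with
  | zero =>
    refine ⟨?_, by simpa using hf⟩
    simpa using (continuousOn_congr hf).2 hcont
  | succ m ih =>
    have hder : ∀ x ∈ U, HasDerivAt f (W (m + 1) x) x := fun x hx =>
      (hW m x hx).congr_of_eventuallyEq (hf.eventuallyEq_of_mem (hU.mem_nhds hx))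
    obtain ⟨h1, h2⟩ := ih (f := deriv f) fun x hx => (hder x hx).deriv
    refine ⟨?_, by rwa [iteratedDeriv_succ']⟩
    have := (contDiffOn_succ_iff_deriv_of_isOpen (n := (m : WithTop ℕ∞)) hU (f := f) (𝕜 := ℝ)).2
      ⟨fun x hx => (hder x hx).differentiableAt.differentiableWithinAt, by simp, h1⟩
    exact_mod_cast this

/-- A tower of kernels each of which is the antiderivative of the preceding one. The images of `φ`
are then iterated primitives of the image under the first kernel. The exponents `δ + j` record that
each step makes the kernel less singular at `0`. -/
structure IsKernelTower (T δ : ℝ) (κ : ℕ → ℝ → ℂ) : Prop where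
  pos : 0 < δ
  singular : ∀ j : ℕ, IsWeaklySingular T (δ + j) (κ j)
  succ : ∀ (j : ℕ) (t : ℝ), 0 < t → κ (j + 1) t = volterra 0 (fun _ => 1) (κ j) t

lemma isWeaklySingular_one (T : ℝ) : IsWeaklySingular T 1 fun _ => 1 :=
  ⟨continuousOn_const, 1, zero_le_one, by simp⟩

lemma isWeaklySingular_cpow (T : ℝ) (l : ℂ) :
    IsWeaklySingular T l.re fun t : ℝ => (t : ℂ) ^ (l - 1) := by
  refine ⟨fun t ht => ?_, 1, zero_le_one, fun t ht => ?_⟩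
  · exact (Complex.continuousAt_ofReal_cpow_const t _ (Or.inr (ne_of_gt ht))).continuousWithinAt
  · rw [Complex.norm_cpow_eq_rpow_re_of_pos ht.1]
    simp

namespace IsKernelTower

variable {a b δ : ℝ} {κ : ℕ → ℝ → ℂ} {φ : ℝ → ℂ}

lemma volterra_succ (h : IsKernelTower (b - a) δ κ) (hφ : IntegrableOn φ (Ioo a b)) (j : ℕ)
    {x : ℝ} (hx : x ∈ Ioo a b) :
    volterra a (κ (j + 1)) φ x = ∫ t in a..x, volterra a (κ j) φ t := by
  have hj : (0 : ℝ) ≤ j := j.cast_nonneg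
  have h1 := (volterra_volterra one_pos (by linarith [h.pos] : 0 < δ + j) (by linarith [h.pos])
    (isWeaklySingular_one _) (h.singular j) hφ hx).2
  rw [volterra_congr hx.1.le (h.succ j), ← h1]
  simp [volterra]

lemma intervalIntegrable (h : IsKernelTower (b - a) δ κ) (hφ : IntegrableOn φ (Ioo a b)) (j : ℕ)
    {x : ℝ} (hx : x ∈ Ioo a b) : IntervalIntegrable (volterra a (κ j) φ) volume a x := by
  have hj : (0 : ℝ) ≤ j := j.cast_nonneg
  rw [intervalIntegrable_iff_integrableOn_Ioo_of_le hx.1.le]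
  exact (integrableOn_volterra (by linarith [h.pos]) (h.singular j) hφ).mono_set
    (Ioo_subset_Ioo_right hx.2.le)

lemma continuousOn_succ (h : IsKernelTower (b - a) δ κ) (hφ : IntegrableOn φ (Ioo a b)) (j : ℕ) :
    ContinuousOn (volterra a (κ (j + 1)) φ) (Ioo a b) := by
  have hj : (0 : ℝ) ≤ j := j.cast_nonneg
  rcases le_or_gt b a with hba | hab
  · simp [Ioo_eq_empty (not_lt.2 hba)]
  have hint : IntegrableOn (volterra a (κ j) φ) (uIcc a b) := by
    rw [uIcc_of_le hab.le, integrableOn_Icc_iff_integrableOn_Ioo]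
    exact integrableOn_volterra (by linarith [h.pos]) (h.singular j) hφ
  have := (intervalIntegral.continuousOn_primitive_interval hint).mono
    (Ioo_subset_Icc_self.trans (Icc_subset_uIcc))
  exact this.congr fun x hx => h.volterra_succ hφ j hx

/-- The fundamental theorem of calculus for the tower, at a point where the lower term is
continuous. -/
lemma hasDerivAt_of_continuousOn (h : IsKernelTower (b - a) δ κ) (hφ : IntegrableOn φ (Ioo a b))
    (j : ℕ) (hc : ContinuousOn (volterra a (κ j) φ) (Ioo a b)) {x : ℝ} (hx : x ∈ Ioo a b) :
    HasDerivAt (volterra a (κ (j + 1)) φ) (volterra a (κ j) φ x) x := by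
  have h1 := intervalIntegral.integral_hasDerivAt_right (h.intervalIntegrable hφ j hx)
    (hc.stronglyMeasurableAtFilter isOpen_Ioo x hx) (hc.continuousAt (isOpen_Ioo.mem_nhds hx))
  refine h1.congr_of_eventuallyEq ?_
  filter_upwards [isOpen_Ioo.mem_nhds hx] with y hy using h.volterra_succ hφ j hy

lemma ae_hasDerivAt (h : IsKernelTower (b - a) δ κ) (hφ : IntegrableOn φ (Ioo a b)) :
    ∀ᵐ x ∂(volume.restrict (Ioo a b)),
      HasDerivAt (volterra a (κ 1) φ) (volterra a (κ 0) φ x) x := by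
  rcases le_or_gt b a with hba | hab
  · simp [Ioo_eq_empty (not_lt.2 hba)]
  have hint : IntervalIntegrable (volterra a (κ 0) φ) volume a b := by
    rw [intervalIntegrable_iff_integrableOn_Ioo_of_le hab.le]
    exact integrableOn_volterra (by have := h.pos; simpa) (h.singular 0) hφ
  filter_upwards [ae_restrict_of_ae hint.ae_hasDerivAt_integral,
    ae_restrict_mem measurableSet_Ioo] with x hx hx'
  have h1 := hx (Ioo_subset_Icc_self.trans Icc_subset_uIcc hx') a left_mem_uIcc
  refine h1.congr_of_eventuallyEq ?_
  filter_upwards [isOpen_Ioo.mem_nhds hx'] with y hy using h.volterra_succ hφ 0 hy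

/-- The `m`-th derivative of the image of `φ` under the kernel of index `m + 1`. -/
lemma contDiffOn_iteratedDeriv (h : IsKernelTower (b - a) δ κ) (hφ : IntegrableOn φ (Ioo a b))
    (m : ℕ) {f : ℝ → ℂ} (hf : EqOn f (volterra a (κ (m + 1)) φ) (Ioo a b)) :
    ContDiffOn ℝ m f (Ioo a b) ∧
      EqOn (iteratedDeriv m f) (volterra a (κ 1) φ) (Ioo a b) :=
  contDiffOn_of_hasDerivAt_chain isOpen_Ioo (W := fun j => volterra a (κ j) φ)
    (h.continuousOn_succ hφ 0)
    (fun j _ hx => h.hasDerivAt_of_continuousOn hφ (j + 1) (h.continuousOn_succ hφ j) hx) m hf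

end IsKernelTower

/-! ### The Mellin-Barnes kernels and their loops -/

lemma norm_cpow_le_exp {z : ℂ} (hz : z ≠ 0) (ξ : ℂ) :
    ‖z ^ ξ‖ ≤ Real.exp (Real.log ‖z‖ * ξ.re + Real.pi * |ξ.im|) := by
  rw [Complex.norm_cpow_of_ne_zero hz, Real.rpow_def_of_pos (norm_pos_iff.2 hz), ← Real.exp_sub]
  refine Real.exp_le_exp.2 ?_
  have h1 : |z.arg * ξ.im| ≤ Real.pi * |ξ.im| := by
    rw [abs_mul]
    exact mul_le_mul_of_nonneg_right (Complex.abs_arg_le_pi z) (abs_nonneg _)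
  linarith [neg_abs_le (z.arg * ξ.im)]

/-- `θ` decays faster than every exponential on `loopStrip c R R'` as
`Re ξ → ∞`. -/
def HasRapidDecayOn (c R R' : ℝ) (θ : ℂ → ℂ) : Prop :=
  ∀ κ : ℝ, ∃ C, 0 ≤ C ∧ ∀ ξ ∈ loopStrip c R R', ‖θ ξ‖ ≤ C * Real.exp (κ * ξ.re)

lemma HasRapidDecayOn.mul {c R R' κ C : ℝ} {θ F : ℂ → ℂ} (h : HasRapidDecayOn c R R' θ)
    (hF : ∀ ξ ∈ loopStrip c R R', ‖F ξ‖ ≤ C * Real.exp (κ * ξ.re)) :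
    HasRapidDecayOn c R R' fun ξ => θ ξ * F ξ := by
  intro κ'
  obtain ⟨C', hC', hb⟩ := h (κ' - κ)
  refine ⟨C' * max C 0, by positivity, fun ξ hξ => ?_⟩
  rw [norm_mul]
  calc _ ≤ (C' * Real.exp ((κ' - κ) * ξ.re)) * (max C 0 * Real.exp (κ * ξ.re)) :=
        mul_le_mul (hb ξ hξ) ((hF ξ hξ).trans (mul_le_mul_of_nonneg_right (le_max_left _ _)
          (Real.exp_pos _).le)) (norm_nonneg _) (by positivity)
    _ = C' * max C 0 * (Real.exp ((κ' - κ) * ξ.re) * Real.exp (κ * ξ.re)) := by ring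
    _ = _ := by rw [← Real.exp_add]; congr 2; ring

lemma HasRapidDecayOn.mul_cpow {c R R' : ℝ} {θ : ℂ → ℂ} (h : HasRapidDecayOn c R R' θ) {z : ℂ}
    (hz : z ≠ 0) : HasRapidDecayOn c R R' fun ξ => θ ξ * z ^ ξ := by
  refine h.mul (κ := Real.log ‖z‖) (C := Real.exp (Real.pi * R')) fun ξ hξ => ?_
  refine (norm_cpow_le_exp hz ξ).trans ?_
  rw [← Real.exp_add]
  refine Real.exp_le_exp.2 ?_
  have := mul_le_mul_of_nonneg_left hξ.2.1 Real.pi_pos.le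
  linarith

lemma loopIntegral_mul_cpow_eq {c₁ c₂ R₁ R₂ : ℝ} (h₁ : 0 ≤ R₁) (h₂ : 0 ≤ R₂) {θ : ℂ → ℂ} {z : ℂ}
    (hz : z ≠ 0)
    (hd : ∀ ξ : ℂ, min c₁ c₂ ≤ ξ.re → (ξ.re ≤ max c₁ c₂ ∨ min R₁ R₂ ≤ |ξ.im|) →
      DifferentiableAt ℂ θ ξ)
    (hdecay : HasRapidDecayOn (min c₁ c₂) (min R₁ R₂) (max R₁ R₂) θ) :
    loopIntegral (fun ξ => θ ξ * z ^ ξ) c₁ R₁ = loopIntegral (fun ξ => θ ξ * z ^ ξ) c₂ R₂ := by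
  obtain ⟨C, -, hC⟩ := (hdecay.mul_cpow hz) (-1)
  refine loopIntegral_eq_loopIntegral (C := C) h₁ h₂ (fun ξ ha hb => (hd ξ ha hb).mul ?_)
    (fun ξ hξ => by simpa using hC ξ hξ)
  exact differentiableAt_id.const_cpow (Or.inl hz)

lemma loopIntegral_congr {f g : ℂ → ℂ} {c : ℝ} (R : ℝ) (h : ∀ ξ : ℂ, c ≤ ξ.re → f ξ = g ξ) :
    loopIntegral f c R = loopIntegral g c R := by
  unfold loopIntegral
  congr 1
  · congr 1
    · congr 1
      exact setIntegral_congr_fun measurableSet_Ioi fun s hs => h _ (by simpa using le_of_lt hs)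
    · congr 1
      exact intervalIntegral.integral_congr fun y _ => h _ (by simp)
  · exact setIntegral_congr_fun measurableSet_Ioi fun s hs => h _ (by simpa using le_of_lt hs)

section LoopDensity

variable {c R : ℝ} {θ : ℂ → ℂ}

lemma loopPath_re_le (hR : 0 ≤ R) (c s : ℝ) : (loopPath c R s).re ≤ |c| + |s| := by
  rw [loopPath_re]
  exact add_le_add (le_abs_self c) (max_le (abs_nonneg s) (by linarith))

/-- The density, with respect to arc length, of the loop integral of `θ(ξ) z^ξ / (2πi)`. -/
noncomputable def loopDensity (θ : ℂ → ℂ) (c R : ℝ) (z : ℂ) (s : ℝ) : ℂ :=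
  1 / (2 * Real.pi * Complex.I) * (θ (loopPath c R s) * z ^ loopPath c R s * loopTangent R s)

lemma isRapid_loopDensity (hR : 0 ≤ R) (hθ : ContinuousOn θ (loopStrip c R R))
    (hdecay : HasRapidDecayOn c R R θ) {z : ℂ} (hz : z ≠ 0) : IsRapid (loopDensity θ c R z) := by
  refine ⟨?_, fun ρ => ?_⟩
  · have h1 : Continuous fun s => θ (loopPath c R s) :=
      hθ.comp_continuous (continuous_loopPath c R) (loopPath_mem_loopStrip hR c)
    have h2 : Continuous fun s => z ^ loopPath c R s :=
      (continuous_loopPath c R).const_cpow (Or.inl hz)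
    exact ((h1.mul h2).measurable.mul (measurable_loopTangent R)).const_mul _
  · obtain ⟨C, hC, hb⟩ := (hdecay.mul_cpow hz) (-|ρ|)
    refine ⟨‖(1 / (2 * Real.pi * Complex.I) : ℂ)‖ * (C * Real.exp (|ρ| * (R - c))), fun s => ?_⟩
    rw [loopDensity, norm_mul, norm_mul (θ (loopPath c R s) * z ^ loopPath c R s) (loopTangent R s),
      norm_loopTangent, mul_one,
      mul_assoc ‖(1 / (2 * Real.pi * Complex.I) : ℂ)‖]
    refine mul_le_mul_of_nonneg_left ?_ (norm_nonneg _)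
    refine (hb _ (loopPath_mem_loopStrip hR c s)).trans ?_
    rw [mul_assoc, ← Real.exp_add]
    refine mul_le_mul_of_nonneg_left (Real.exp_le_exp.2 ?_) hC
    have h1 : c + (|s| - R) ≤ (loopPath c R s).re := by
      rw [loopPath_re]; linarith [le_max_right 0 (|s| - R)]
    have h2 := mul_le_mul_of_nonneg_left h1 (abs_nonneg ρ)
    have h3 := mul_le_mul_of_nonneg_right (le_abs_self ρ) (abs_nonneg s)
    linarith

lemma isExponent_loopPath (hR : 0 ≤ R) (c : ℝ) (d : ℂ) {α : ℝ} (hα : 0 < α) :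
    IsExponent (d.re + α * c) fun s => d + α * loopPath c R s := by
  refine ⟨continuous_const.add (continuous_const.mul (continuous_loopPath c R)), fun s => ?_,
    d.re + α * |c|, α, fun s => ?_⟩
  · have := mul_le_mul_of_nonneg_left (le_loopPath_re c R s) hα.le
    rw [Complex.add_re, Complex.re_ofReal_mul]
    linarith
  · have := mul_le_mul_of_nonneg_left (loopPath_re_le hR c s) hα.le
    rw [Complex.add_re, Complex.re_ofReal_mul]
    linarith

lemma mul_ofReal_cpow {z : ℂ} (hz : z ≠ 0) {r : ℝ} (hr : 0 < r) (ξ : ℂ) :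
    (z * r) ^ ξ = z ^ ξ * (r : ℂ) ^ ξ := by
  have hr' : (r : ℂ) ≠ 0 := by exact_mod_cast hr.ne'
  rw [Complex.cpow_def_of_ne_zero (mul_ne_zero hz hr'), Complex.cpow_def_of_ne_zero hz,
    Complex.cpow_def_of_ne_zero hr', mul_comm z, Complex.log_ofReal_mul hr hz, ← Complex.exp_add,
    ← Complex.ofReal_log hr.le]
  ring_nf

/-- The kernel of an operator `hOperator`, as a superposition of powers. -/
lemma cpow_mul_loopIntegral_eq_powerMix (hR : 0 ≤ R) (hθ : ContinuousOn θ (loopStrip c R R))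
    (hdecay : HasRapidDecayOn c R R θ) {w : ℂ} (hw : w ≠ 0) (α : ℝ) (d : ℂ) {t : ℝ} (ht : 0 < t) :
    (t : ℂ) ^ (d - 1) * (1 / (2 * Real.pi * Complex.I) *
      loopIntegral (fun ξ => θ ξ * (w * ((t ^ α : ℝ) : ℂ)) ^ ξ) c R) =
      powerMix (loopDensity θ c R w) (fun s => d + α * loopPath c R s) t := by
  have htα : 0 < t ^ α := Real.rpow_pos_of_pos ht α
  have ht' : (t : ℂ) ≠ 0 := by exact_mod_cast ht.ne'
  have hz : w * ((t ^ α : ℝ) : ℂ) ≠ 0 := mul_ne_zero hw (by exact_mod_cast htα.ne')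
  have hpi : (1 / (2 * Real.pi * Complex.I) : ℂ) ≠ 0 :=
    one_div_ne_zero Complex.two_pi_I_ne_zero
  have hint := (isRapid_loopDensity hR hθ hdecay hz).integrable
  have hint' : Integrable fun s => θ (loopPath c R s) *
      (w * ((t ^ α : ℝ) : ℂ)) ^ loopPath c R s * loopTangent R s := by
    have := hint.const_mul (1 / (2 * Real.pi * Complex.I) : ℂ)⁻¹
    simpa only [loopDensity, inv_mul_cancel_left₀ hpi] using this
  rw [loopIntegral_eq_integral_loopPath (f := fun ξ => θ ξ * (w * ((t ^ α : ℝ) : ℂ)) ^ ξ) hR hint',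
    ← integral_const_mul, ← integral_const_mul, powerMix]
  refine integral_congr_ae (Eventually.of_forall fun s => ?_)
  beta_reduce
  have h1 : (t : ℂ) ^ (d + α * loopPath c R s - 1) =
      (t : ℂ) ^ (d - 1) * (t : ℂ) ^ (α * loopPath c R s) := by
    rw [← Complex.cpow_add _ _ ht']; congr 1; ring
  have h2 : ((t ^ α : ℝ) : ℂ) ^ loopPath c R s = (t : ℂ) ^ (α * loopPath c R s) := by
    rw [Complex.ofReal_cpow ht.le, Complex.cpow_def_of_ne_zero ht' (α * loopPath c R s),
      Complex.cpow_def_of_ne_zero ht' α, Complex.cpow_def_of_ne_zero (Complex.exp_ne_zero _),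
      ← Complex.ofReal_log ht.le, ← Complex.ofReal_mul, ← Complex.ofReal_exp,
      ← Complex.ofReal_log (Real.exp_pos _).le, Real.log_exp]
    push_cast
    ring_nf
  rw [mul_ofReal_cpow hw htα, h1, h2, loopDensity]
  ring

end LoopDensity

/-! ### The generalized Macdonald function and its fractional derivative -/

section Macdonald

variable {η ν α : ℝ} {σ β μ : ℂ} {c R : ℝ}

lemma foxTheta_macdonaldParams (η : ℝ) (σ : ℂ) (ν : ℝ) (ξ : ℂ) :
    foxTheta 2 0 (macdonaldParams η σ ν) ξ =
      Complex.Gamma (0 - (1 : ℝ) * ξ) * (Complex.Gamma (-σ - ν / η - (1 / η : ℝ) * ξ) *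
        (Complex.Gamma (1 - (ν + 1) / η - (1 / η : ℝ) * ξ))⁻¹) := by
  simp [foxTheta, macdonaldParams, Fin.prod_univ_two, mul_assoc]

lemma foxTheta_macdonaldDerivParams {ξ : ℂ}
    (h : 0 < (β + rlOrder μ - μ + α * ξ).re) :
    foxTheta 2 2 (macdonaldDerivParams η σ ν α β μ) ξ =
      foxTheta 2 0 (macdonaldParams η σ ν) ξ *
        (Complex.Gamma (β + α * ξ) * (Complex.Gamma (β - μ + α * ξ))⁻¹) := by
  have hne := Complex.Gamma_ne_zero_of_re_pos h
  rw [foxTheta_macdonaldParams]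
  simp only [foxTheta, macdonaldDerivParams, Fin.prod_univ_four, Fin.prod_univ_three]
  have e1 : 1 - (1 - β - (rlOrder μ : ℂ) + μ) + α * ξ = β + rlOrder μ - μ + α * ξ := by ring
  have e3 : 1 - (1 - β + μ) + α * ξ = β - μ + α * ξ := by ring
  simp [e1, e3]
  generalize Complex.Gamma (β + rlOrder μ - μ + α * ξ) = g at hne ⊢
  field_simp

/-- The condition on a loop for the generalized Macdonald function, written out. -/
lemma foxSeparates_macdonaldParams_iff (hη : 0 < η) :
    FoxSeparates 2 0 (macdonaldParams η σ ν) c R ↔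
      0 < R ∧ c < 0 ∧ c < -(η * σ.re) - ν ∧ η * |σ.im| < R := by
  have hpole : ∀ k : ℕ, (-σ - ν / η + k) / ((1 / η : ℝ) : ℂ) =
      ((-(η * σ.re) - ν + η * k : ℝ) : ℂ) + ((-(η * σ.im) : ℝ) : ℂ) * Complex.I := by
    intro k
    have hη' : (η : ℂ) ≠ 0 := by exact_mod_cast hη.ne'
    conv_lhs => rw [← Complex.re_add_im σ]
    push_cast
    field_simp
    ring
  have hre : ∀ k : ℕ, ((-σ - ν / η + k) / ((1 / η : ℝ) : ℂ)).re = -(η * σ.re) - ν + η * k := by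
    intro k; rw [hpole]; simp
  have him : ∀ k : ℕ, |((-σ - ν / η + k) / ((1 / η : ℝ) : ℂ)).im| = η * |σ.im| := by
    intro k; rw [hpole]; simp [abs_mul, abs_of_pos hη]
  constructor
  · rintro ⟨h1, h2, -⟩
    have h3 := h2 0 (by norm_num) 0
    have h4 := h2 1 (by norm_num) 0
    simp only [macdonaldParams, Matrix.cons_val_one, Matrix.cons_val_zero,
      Matrix.cons_val_fin_one] at h3 h4
    rw [hre, him] at h4
    exact ⟨h1, by simpa using h3.1, by simpa using h4.1, h4.2⟩
  · rintro ⟨h1, h2, h3, h4⟩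
    refine ⟨h1, fun j _ k => ?_, fun j hj => absurd hj (Nat.not_lt_zero _)⟩
    have hk : (0 : ℝ) ≤ k := k.cast_nonneg
    fin_cases j
    · simp [macdonaldParams, h1]
      linarith
    · simp only [macdonaldParams, Fin.mk_one, Matrix.cons_val_one, Matrix.cons_val_fin_one]
      rw [hre, him]
      exact ⟨by nlinarith [mul_nonneg hη.le hk], h4⟩

lemma foxSeparates_macdonaldDerivParams_iff (hα : 0 < α) :
    FoxSeparates 2 2 (macdonaldDerivParams η σ ν α β μ) c R ↔
      FoxSeparates 2 0 (macdonaldParams η σ ν) c R ∧ 0 < β.re + α * c ∧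
        0 < (β + rlOrder μ - μ).re + α * c := by
  have hpole : ∀ (z : ℂ) (k : ℕ), ((z - 1 - k) / (α : ℂ)).re < c ↔ (z - 1).re < α * c + k := by
    intro z k
    rw [Complex.div_ofReal_re, div_lt_iff₀ hα]
    simp only [Complex.sub_re, Complex.one_re, Complex.natCast_re]
    rw [mul_comm c]
    constructor <;> intro h <;> linarith
  constructor
  · rintro ⟨h1, h2, h3⟩
    refine ⟨⟨h1, fun j hj k => ?_, fun j hj => absurd hj (Nat.not_lt_zero _)⟩, ?_, ?_⟩
    · fin_cases j
      · exact h2 0 (by norm_num) k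
      · exact h2 1 (by norm_num) k
    · have := (hpole _ 0).1 (h3 0 (by norm_num) 0)
      simp [macdonaldDerivParams] at this
      linarith
    · have := (hpole _ 0).1 (h3 1 (by norm_num) 0)
      simp [macdonaldDerivParams] at this
      simp
      linarith
  · rintro ⟨⟨h1, h2, -⟩, h3, h4⟩
    refine ⟨h1, fun j hj k => ?_, fun j hj k => ?_⟩
    · fin_cases j
      · exact h2 0 (by norm_num) k
      · exact h2 1 (by norm_num) k
      · simp at hj
      · simp at hj
    · have hk : (0 : ℝ) ≤ k := k.cast_nonneg
      fin_cases j
      · refine (hpole _ k).2 ?_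
        simp [macdonaldDerivParams]
        linarith
      · refine (hpole _ k).2 ?_
        simp [macdonaldDerivParams]
        simp at h4
        linarith
      · simp at hj

lemma differentiableAt_foxTheta_macdonaldParams (hη : 0 < η)
    (hsep : FoxSeparates 2 0 (macdonaldParams η σ ν) c R) {ξ : ℂ}
    (hξ : ξ.re ≤ c ∨ R ≤ |ξ.im|) :
    DifferentiableAt ℂ (foxTheta 2 0 (macdonaldParams η σ ν)) ξ := by
  rw [funext (foxTheta_macdonaldParams η σ ν)]
  refine (differentiableAt_Gamma_sub_mul one_pos (hsep.2.1 0 (by norm_num)) hξ).mul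
    ((differentiableAt_Gamma_sub_mul (one_div_pos.2 hη) (hsep.2.1 1 (by norm_num)) hξ).mul ?_)
  exact (Complex.differentiable_one_div_Gamma _).comp ξ
    (f := fun ξ : ℂ => 1 - (ν + 1) / η - ((1 / η : ℝ) : ℂ) * ξ) (by fun_prop)

lemma hasRapidDecayOn_foxTheta_macdonaldParams (hη : 0 < η)
    (hsep : FoxSeparates 2 0 (macdonaldParams η σ ν) c R) (R' : ℝ) :
    HasRapidDecayOn c R R' (foxTheta 2 0 (macdonaldParams η σ ν)) := by
  rw [funext (foxTheta_macdonaldParams η σ ν)]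
  obtain ⟨κ, C, -, hC⟩ := exists_norm_Gamma_sub_mul_div_le (R' := R') (one_div_pos.2 hη)
    (1 - (ν + 1) / η) (hsep.2.1 1 (by norm_num))
  exact HasRapidDecayOn.mul (fun κ => exists_norm_Gamma_sub_mul_le one_pos
    (hsep.2.1 0 (by norm_num)) κ) hC

lemma differentiableAt_Gamma_add_mul_div (v : ℂ) {ξ : ℂ} (hξ : 0 < β.re + α * ξ.re) :
    DifferentiableAt ℂ
      (fun ξ => Complex.Gamma (β + α * ξ) * (Complex.Gamma (v + α * ξ))⁻¹) ξ := by
  refine DifferentiableAt.mul ?_ ((Complex.differentiable_one_div_Gamma _).comp ξ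
    (f := fun ξ : ℂ => v + α * ξ) (by fun_prop))
  refine DifferentiableAt.comp (f := fun ξ : ℂ => β + α * ξ) (g := Complex.Gamma) ξ
    (Complex.differentiableAt_Gamma _ fun m hm => ?_) (by fun_prop)
  have h := congrArg Complex.re hm
  rw [Complex.add_re, Complex.re_ofReal_mul] at h
  simp at h
  linarith [(Nat.cast_nonneg m : (0 : ℝ) ≤ m)]

lemma foxSeparates_min_max (hη : 0 < η) {c₁ c₂ R₁ R₂ : ℝ}
    (h₁ : FoxSeparates 2 0 (macdonaldParams η σ ν) c₁ R₁)
    (h₂ : FoxSeparates 2 0 (macdonaldParams η σ ν) c₂ R₂) :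
    FoxSeparates 2 0 (macdonaldParams η σ ν) (min c₁ c₂) (min R₁ R₂) ∧
      FoxSeparates 2 0 (macdonaldParams η σ ν) (max c₁ c₂) (min R₁ R₂) := by
  rw [foxSeparates_macdonaldParams_iff hη] at h₁ h₂ ⊢
  rw [foxSeparates_macdonaldParams_iff hη]
  simp only [lt_min_iff, max_lt_iff, min_lt_iff]
  tauto

/-- The value of the generalized Macdonald function may be computed with any admissible loop. -/
lemma foxH_macdonaldParams (hη : 0 < η) (hsep : FoxSeparates 2 0 (macdonaldParams η σ ν) c R)
    {z : ℂ} (hz : z ≠ 0) :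
    foxH 2 0 (macdonaldParams η σ ν) z = 1 / (2 * Real.pi * Complex.I) *
      loopIntegral (fun ξ => foxTheta 2 0 (macdonaldParams η σ ν) ξ * z ^ ξ) c R := by
  have hex : ∃ L : ℝ × ℝ, FoxSeparates 2 0 (macdonaldParams η σ ν) L.1 L.2 := ⟨(c, R), hsep⟩
  rw [foxH, dif_pos hex]
  have hch := hex.choose_spec
  congr 1
  obtain ⟨hmin, hmax⟩ := foxSeparates_min_max hη hch hsep
  exact loopIntegral_mul_cpow_eq hch.1.le hsep.1.le hz
    (fun ξ _ h => differentiableAt_foxTheta_macdonaldParams hη hmax h)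
    (hasRapidDecayOn_foxTheta_macdonaldParams hη hmin _)

/-- The kernel of `foxH 2 2 (macdonaldDerivParams η σ ν α β μ)` after the common Gamma factor has
been cancelled. -/
noncomputable def macdonaldDerivTheta (η : ℝ) (σ : ℂ) (ν α : ℝ) (β d ξ : ℂ) : ℂ :=
  foxTheta 2 0 (macdonaldParams η σ ν) ξ *
    (Complex.Gamma (β + α * ξ) * (Complex.Gamma (d + α * ξ))⁻¹)

lemma differentiableAt_macdonaldDerivTheta (hη : 0 < η)
    (hsep : FoxSeparates 2 0 (macdonaldParams η σ ν) c R) (d : ℂ) {ξ : ℂ}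
    (hξ : ξ.re ≤ c ∨ R ≤ |ξ.im|) (hβ : 0 < β.re + α * ξ.re) :
    DifferentiableAt ℂ (macdonaldDerivTheta η σ ν α β d) ξ :=
  (differentiableAt_foxTheta_macdonaldParams hη hsep hξ).mul
    (differentiableAt_Gamma_add_mul_div d hβ)

lemma hasRapidDecayOn_macdonaldDerivTheta (hη : 0 < η) (hα : 0 < α)
    (hsep : FoxSeparates 2 0 (macdonaldParams η σ ν) c R) (d : ℂ) (hβ : 0 < β.re + α * c)
    (R' : ℝ) : HasRapidDecayOn c R R' (macdonaldDerivTheta η σ ν α β d) := by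
  obtain ⟨κ, C, -, hC⟩ := exists_norm_Gamma_add_mul_div_le R R' hα d hβ
  exact (hasRapidDecayOn_foxTheta_macdonaldParams hη hsep R').mul hC

lemma foxH_macdonaldDerivParams (hη : 0 < η) (hα : 0 < α)
    (hsep : FoxSeparates 2 2 (macdonaldDerivParams η σ ν α β μ) c R) {z : ℂ} (hz : z ≠ 0) :
    foxH 2 2 (macdonaldDerivParams η σ ν α β μ) z = 1 / (2 * Real.pi * Complex.I) *
      loopIntegral (fun ξ => macdonaldDerivTheta η σ ν α β (β - μ) ξ * z ^ ξ) c R := by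
  have hex : ∃ L : ℝ × ℝ, FoxSeparates 2 2 (macdonaldDerivParams η σ ν α β μ) L.1 L.2 :=
    ⟨(c, R), hsep⟩
  rw [foxH, dif_pos hex]
  obtain ⟨hch, hch₁, hch₂⟩ := (foxSeparates_macdonaldDerivParams_iff hα).1 hex.choose_spec
  obtain ⟨hsep', hs₁, -⟩ := (foxSeparates_macdonaldDerivParams_iff hα).1 hsep
  obtain ⟨hmin, hmax⟩ := foxSeparates_min_max hη hch hsep'
  have hβmin : 0 < β.re + α * min hex.choose.1 c := by
    rcases min_choice hex.choose.1 c with h | h <;> rw [h] <;> assumption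
  congr 1
  refine (loopIntegral_congr _ fun ξ hξ => ?_).trans
    (loopIntegral_mul_cpow_eq hch.1.le hsep.1.le hz (fun ξ h1 h2 =>
      differentiableAt_macdonaldDerivTheta hη hmax (β - μ) h2 ?_)
    (hasRapidDecayOn_macdonaldDerivTheta hη hα hmin (β - μ) hβmin _))
  · have := mul_le_mul_of_nonneg_left hξ hα.le
    rw [foxTheta_macdonaldDerivParams, macdonaldDerivTheta]
    rw [Complex.add_re, Complex.re_ofReal_mul]
    linarith
  · have := mul_le_mul_of_nonneg_left h1 hα.le
    linarith

end Macdonald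

/-! ### The kernels of the operators, and the main theorem -/

section Kernels

variable {η ν α : ℝ} {σ β μ w : ℂ} {c R : ℝ}

/-- The kernel `1 / (2πi) ∫ θ(ξ) Γ(β + α ξ) / Γ(d + α ξ) w^ξ t^(d - 1 + α ξ) dξ`, where `θ` is the
Mellin-Barnes kernel of the generalized Macdonald function. Raising `d` by `l` amounts to
fractional integration of order `l`. -/
noncomputable def macdonaldKernel (η : ℝ) (σ : ℂ) (ν α : ℝ) (β w : ℂ) (c R : ℝ) (d : ℂ) :
    ℝ → ℂ :=
  powerMix (loopDensity (macdonaldDerivTheta η σ ν α β d) c R w)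
    (fun s => d + α * loopPath c R s)

lemma continuousOn_macdonaldDerivTheta (hη : 0 < η) (hα : 0 < α)
    (hsep : FoxSeparates 2 0 (macdonaldParams η σ ν) c R) (hβ : 0 < β.re + α * c) (d : ℂ) :
    ContinuousOn (macdonaldDerivTheta η σ ν α β d) (loopStrip c R R) := fun ξ hξ =>
  (differentiableAt_macdonaldDerivTheta hη hsep d (hξ.2.2.imp le_of_eq id)
    (by linarith [mul_le_mul_of_nonneg_left hξ.1 hα.le])).continuousAt.continuousWithinAt

lemma isRapid_loopDensity_macdonaldDerivTheta (hη : 0 < η) (hα : 0 < α) (hw : w ≠ 0)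
    (hsep : FoxSeparates 2 0 (macdonaldParams η σ ν) c R) (hβ : 0 < β.re + α * c) (d : ℂ) :
    IsRapid (loopDensity (macdonaldDerivTheta η σ ν α β d) c R w) :=
  isRapid_loopDensity hsep.1.le (continuousOn_macdonaldDerivTheta hη hα hsep hβ d)
    (hasRapidDecayOn_macdonaldDerivTheta hη hα hsep d hβ R) hw

lemma isWeaklySingular_macdonaldKernel (hη : 0 < η) (hα : 0 < α) (hw : w ≠ 0)
    (hsep : FoxSeparates 2 0 (macdonaldParams η σ ν) c R) (hβ : 0 < β.re + α * c) (d : ℂ) (T : ℝ) :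
    IsWeaklySingular T (d.re + α * c) (macdonaldKernel η σ ν α β w c R d) := by
  have hG := isRapid_loopDensity_macdonaldDerivTheta hη hα hw hsep hβ d
  have he := isExponent_loopPath hsep.1.le c d hα
  exact ⟨continuousOn_powerMix hG he, exists_norm_powerMix_le hG he T⟩

/-- Fractional integration of order `l` of the kernel. -/
lemma volterra_cpow_macdonaldKernel (hη : 0 < η) (hα : 0 < α) (hw : w ≠ 0)
    (hsep : FoxSeparates 2 0 (macdonaldParams η σ ν) c R) (hβ : 0 < β.re + α * c) {d : ℂ}
    (hd : 0 < d.re + α * c) {l : ℂ} (hl : 0 < l.re) {t : ℝ} (ht : 0 < t) :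
    volterra 0 (fun u : ℝ => (u : ℂ) ^ (l - 1)) (macdonaldKernel η σ ν α β w c R d) t =
      Complex.Gamma l * macdonaldKernel η σ ν α β w c R (d + l) t := by
  rw [volterra, macdonaldKernel, integral_cpow_mul_powerMix hd
    (isRapid_loopDensity_macdonaldDerivTheta hη hα hw hsep hβ d)
    (isExponent_loopPath hsep.1.le c d hα) hl ht, macdonaldKernel, powerMix, powerMix,
    ← integral_const_mul]
  refine integral_congr_ae (Eventually.of_forall fun s => ?_)
  have hne : Complex.Gamma (d + α * loopPath c R s) ≠ 0 := by
    refine Complex.Gamma_ne_zero_of_re_pos ?_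
    have := mul_le_mul_of_nonneg_left (le_loopPath_re c R s) hα.le
    rw [Complex.add_re, Complex.re_ofReal_mul]
    linarith
  have e1 : d + α * loopPath c R s + l = d + l + α * loopPath c R s := by ring
  simp only [loopDensity, macdonaldDerivTheta, e1]
  generalize Complex.Gamma (d + α * loopPath c R s) = g at hne ⊢
  rw [div_eq_mul_inv]
  linear_combination (1 / (2 * Real.pi * Complex.I) *
    (foxTheta 2 0 (macdonaldParams η σ ν) (loopPath c R s) *
      Complex.Gamma (β + α * loopPath c R s) * w ^ loopPath c R s * loopTangent R s) *
    Complex.Gamma l * (Complex.Gamma (d + l + α * loopPath c R s))⁻¹ *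
    (t : ℂ) ^ (d + l + α * loopPath c R s - 1)) * mul_inv_cancel₀ hne

lemma isKernelTower_macdonaldKernel (hη : 0 < η) (hα : 0 < α) (hw : w ≠ 0)
    (hsep : FoxSeparates 2 0 (macdonaldParams η σ ν) c R) (hβ : 0 < β.re + α * c) {d : ℂ}
    (hd : 0 < d.re + α * c) (T : ℝ) :
    IsKernelTower T (d.re + α * c) fun j => macdonaldKernel η σ ν α β w c R (d + j) := by
  refine ⟨hd, fun j => ?_, fun j t ht => ?_⟩
  · have h := isWeaklySingular_macdonaldKernel hη hα hw hsep hβ (d + j) T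
    have e : (d + j).re + α * c = d.re + α * c + j := by simp; ring
    rwa [e] at h
  · have hj : (0 : ℝ) ≤ j := j.cast_nonneg
    have h := volterra_cpow_macdonaldKernel hη hα hw hsep hβ (d := d + j)
      (by simp; linarith) (l := 1) (by simp) ht
    simp only [sub_self, Complex.cpow_zero, Complex.Gamma_one, one_mul] at h
    rw [h]
    push_cast
    rw [add_assoc]

lemma macdonaldKernel_self (hη : 0 < η) (hα : 0 < α) (hw : w ≠ 0)
    (hsep : FoxSeparates 2 0 (macdonaldParams η σ ν) c R) (hβ : 0 < β.re + α * c) {t : ℝ}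
    (ht : 0 < t) :
    (t : ℂ) ^ (β - 1) * foxH 2 0 (macdonaldParams η σ ν) (w * ((t ^ α : ℝ) : ℂ)) =
      macdonaldKernel η σ ν α β w c R β t := by
  have hz : w * ((t ^ α : ℝ) : ℂ) ≠ 0 :=
    mul_ne_zero hw (by exact_mod_cast (Real.rpow_pos_of_pos ht α).ne')
  rw [foxH_macdonaldParams hη hsep hz, macdonaldKernel,
    ← cpow_mul_loopIntegral_eq_powerMix hsep.1.le
      (continuousOn_macdonaldDerivTheta hη hα hsep hβ β)
      (hasRapidDecayOn_macdonaldDerivTheta hη hα hsep β hβ R) hw α β ht]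
  congr 2
  refine loopIntegral_congr R fun ξ hξ => ?_
  have hne : Complex.Gamma (β + α * ξ) ≠ 0 := by
    refine Complex.Gamma_ne_zero_of_re_pos ?_
    have := mul_le_mul_of_nonneg_left hξ hα.le
    rw [Complex.add_re, Complex.re_ofReal_mul]
    linarith
  rw [macdonaldDerivTheta, mul_inv_cancel₀ hne, mul_one]

lemma macdonaldKernel_sub (hη : 0 < η) (hα : 0 < α) (hw : w ≠ 0)
    (hsep : FoxSeparates 2 2 (macdonaldDerivParams η σ ν α β μ) c R) {t : ℝ} (ht : 0 < t) :
    (t : ℂ) ^ (β - μ - 1) *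
        foxH 2 2 (macdonaldDerivParams η σ ν α β μ) (w * ((t ^ α : ℝ) : ℂ)) =
      macdonaldKernel η σ ν α β w c R (β - μ) t := by
  have hz : w * ((t ^ α : ℝ) : ℂ) ≠ 0 :=
    mul_ne_zero hw (by exact_mod_cast (Real.rpow_pos_of_pos ht α).ne')
  obtain ⟨hsep', hβ, -⟩ := (foxSeparates_macdonaldDerivParams_iff hα).1 hsep
  rw [foxH_macdonaldDerivParams hη hα hsep hz, macdonaldKernel,
    ← cpow_mul_loopIntegral_eq_powerMix hsep.1.le
      (continuousOn_macdonaldDerivTheta hη hα hsep' hβ (β - μ))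
      (hasRapidDecayOn_macdonaldDerivTheta hη hα hsep' (β - μ) hβ R) hw α (β - μ) ht]

/-- A loop for both kernels, far enough to the right for the exponents `β - μ + α ξ` to have
positive real part along it. -/
lemma exists_foxSeparates (hη : 0 < η) (hα : 0 < α) (hμ : 0 < μ.re)
    (hright : HOperatorCondition 2 (macdonaldDerivParams η σ ν α β μ) α (β - μ)) :
    ∃ c R, FoxSeparates 2 2 (macdonaldDerivParams η σ ν α β μ) c R ∧
      0 < (β - μ).re + α * c := by
  obtain ⟨h0, h1⟩ := hright
  have h2 : 0 < (β - μ).re + α * (-(η * σ.re) - ν) := by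
    have h3 := h1 1 (by norm_num)
    have h4 : (α * (macdonaldDerivParams η σ ν α β μ).b 1 /
        (macdonaldDerivParams η σ ν α β μ).B 1 : ℂ) = ((α * η : ℝ) : ℂ) * (-σ - ν / η) := by
      simp [macdonaldDerivParams]; ring
    have h5 : ((ν : ℂ) / η).re = ν / η := by rw [← Complex.ofReal_div, Complex.ofReal_re]
    rw [h4, Complex.re_ofReal_mul, Complex.sub_re (-σ), Complex.neg_re, h5] at h3
    have h6 : α * η * (-σ.re - ν / η) = α * (-(η * σ.re) - ν) := by field_simp
    rwa [h6] at h3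
  obtain ⟨c, hc1, hc2⟩ : ∃ c, -(β - μ).re / α < c ∧ c < min 0 (-(η * σ.re) - ν) := by
    refine exists_between (lt_min ?_ ?_)
    · rw [div_lt_iff₀ hα]; linarith
    · rw [div_lt_iff₀ hα]; linarith
  rw [div_lt_iff₀ hα] at hc1
  have hδ : 0 < (β - μ).re + α * c := by linarith
  have hn : (0 : ℝ) ≤ rlOrder μ := Nat.cast_nonneg _
  refine ⟨c, η * |σ.im| + 1, (foxSeparates_macdonaldDerivParams_iff hα).2
    ⟨(foxSeparates_macdonaldParams_iff hη).2 ⟨by positivity, (lt_min_iff.1 hc2).1,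
      (lt_min_iff.1 hc2).2, by linarith⟩, ?_, ?_⟩, hδ⟩
  · rw [Complex.sub_re] at hδ; linarith
  · rw [Complex.sub_re] at hδ
    simp
    linarith

end Kernels

lemma rlIntegral_eq_volterra (a : ℝ) (l : ℂ) (f : ℝ → ℂ) (x : ℝ) :
    rlIntegral a l f x =
      1 / Complex.Gamma l * volterra a (fun u : ℝ => (u : ℂ) ^ (l - 1)) f x := by
  rw [rlIntegral, volterra]
  congr 2
  funext t
  rw [div_eq_mul_inv, ← Complex.cpow_neg, neg_sub, mul_comm]

theorem corollary6 (a b : ℝ) (hab : a < b) (α : ℝ) (hα : 0 < α)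
    (μ β : ℂ) (hμ : 0 < μ.re) (hβ : 0 < β.re) (w : ℂ) (hw : w ≠ 0)
    (η : ℝ) (hη : 0 < η) (σ : ℂ) (hσ : 1 / η - 1 < σ.re) (ν : ℝ)
    (hleft : HOperatorCondition 2 (macdonaldParams η σ ν) α β)
    (hright : HOperatorCondition 2 (macdonaldDerivParams η σ ν α β μ) α (β - μ))
    (φ : ℝ → ℂ) (hφ : IntegrableOn φ (Ioo a b)) :
    (∀ᵐ x ∂(volume.restrict (Ioo a b)),
      HOperatorExistsAt 2 0 (macdonaldParams η σ ν) a w α β φ x ∧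
      RLDifferentiableAt a μ (hOperator 2 0 (macdonaldParams η σ ν) a w α β φ) x ∧
      HOperatorExistsAt 2 2 (macdonaldDerivParams η σ ν α β μ) a w α (β - μ) φ x ∧
      rlDeriv a μ (hOperator 2 0 (macdonaldParams η σ ν) a w α β φ) x
        = hOperator 2 2 (macdonaldDerivParams η σ ν α β μ) a w α (β - μ) φ x) ∧
    (ContinuousOn φ (Ioo a b) → ∀ x ∈ Ioo a b,
      HOperatorExistsAt 2 0 (macdonaldParams η σ ν) a w α β φ x ∧
      RLDifferentiableAt a μ (hOperator 2 0 (macdonaldParams η σ ν) a w α β φ) x ∧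
      HOperatorExistsAt 2 2 (macdonaldDerivParams η σ ν α β μ) a w α (β - μ) φ x ∧
      rlDeriv a μ (hOperator 2 0 (macdonaldParams η σ ν) a w α β φ) x
        = hOperator 2 2 (macdonaldDerivParams η σ ν α β μ) a w α (β - μ) φ x) := by
  obtain ⟨c, R, hsep, hδ⟩ := exists_foxSeparates hη hα hμ hright
  obtain ⟨hsep', hβc, -⟩ := (foxSeparates_macdonaldDerivParams_iff hα).1 hsep
  set k : ℂ → ℝ → ℂ := macdonaldKernel η σ ν α β w c R with hk
  set f := hOperator 2 0 (macdonaldParams η σ ν) a w α β φ with hf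
  set n := rlOrder μ with hn
  set l : ℂ := (n : ℂ) - μ with hl
  have hlre : 0 < l.re := by
    have := Nat.lt_floor_add_one μ.re
    simp [hl, hn, rlOrder]
    linarith
  have hn1 : (1 : ℝ) ≤ n := by simp [hn, rlOrder]
  have htower := isKernelTower_macdonaldKernel hη hα hw hsep' hβc hδ (b - a)
  rw [← hk] at htower
  have hsing := isWeaklySingular_macdonaldKernel hη hα hw hsep' hβc β (b - a)
  rw [← hk] at hsing
  have hsing0 : IsWeaklySingular (b - a) ((β - μ).re + α * c) (k (β - μ)) := by
    simpa using htower.singular 0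
  have hex₁ : ∀ x ∈ Ioo a b, (HOperatorExistsAt 2 0 (macdonaldParams η σ ν) a w α β φ x ↔
      IntervalIntegrable (fun t => k β (x - t) * φ t) volume a x) := fun x hx =>
    intervalIntegrable_iff_of_eq_on_Ioo hx.1.le fun t ht => by
      rw [hIntegrand, macdonaldKernel_self hη hα hw hsep' hβc (by linarith [ht.2])]
  have hex₂ : ∀ x ∈ Ioo a b,
      (HOperatorExistsAt 2 2 (macdonaldDerivParams η σ ν α β μ) a w α (β - μ) φ x ↔
        IntervalIntegrable (fun t => k (β - μ) (x - t) * φ t) volume a x) := fun x hx =>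
    intervalIntegrable_iff_of_eq_on_Ioo hx.1.le fun t ht => by
      rw [hIntegrand, macdonaldKernel_sub hη hα hw hsep (by linarith [ht.2])]
  have hop₁ : ∀ x ∈ Ioo a b, f x = volterra a (k β) φ x := fun x hx =>
    intervalIntegral_eq_of_eq_on_Ioo hx.1.le fun t ht => by
      rw [hIntegrand, macdonaldKernel_self hη hα hw hsep' hβc (by linarith [ht.2])]
  have hop₂ : ∀ x ∈ Ioo a b, hOperator 2 2 (macdonaldDerivParams η σ ν α β μ) a w α (β - μ) φ x =
      volterra a (k (β - μ)) φ x := fun x hx =>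
    intervalIntegral_eq_of_eq_on_Ioo hx.1.le fun t ht => by
      rw [hIntegrand, macdonaldKernel_sub hη hα hw hsep (by linarith [ht.2])]
  have hcomp : ∀ x ∈ Ioo a b, _ := fun x hx =>
    volterra_volterra hlre hβc (by simp [hl] at hδ ⊢; linarith)
      (isWeaklySingular_cpow (b - a) l) hsing hφ hx
  have hrl_int : ∀ x ∈ Ioo a b,
      IntervalIntegrable (fun t : ℝ => f t / ((x - t : ℝ) : ℂ) ^ (1 - l)) volume a x := fun x hx =>
    (intervalIntegrable_iff_of_eq_on_Ioo hx.1.le fun t ht => by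
      rw [hop₁ t ⟨ht.1, ht.2.trans hx.2⟩, div_eq_mul_inv, ← Complex.cpow_neg, neg_sub,
        mul_comm]).2 (hcomp x hx).1
  have hrl : EqOn (rlIntegral a l f)
      (volterra a ((fun j : ℕ => k (β - μ + j)) (⌊μ.re⌋₊ + 1)) φ) (Ioo a b) := by
    intro x hx
    have hGam : Complex.Gamma l ≠ 0 := Complex.Gamma_ne_zero_of_re_pos hlre
    have h1 : volterra a (fun u : ℝ => (u : ℂ) ^ (l - 1)) f x =
        volterra a (fun u : ℝ => (u : ℂ) ^ (l - 1)) (volterra a (k β) φ) x :=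
      intervalIntegral_eq_of_eq_on_Ioo hx.1.le fun t ht => by
        rw [hop₁ t ⟨ht.1, ht.2.trans hx.2⟩]
    have h2 : β + l = β - μ + ((⌊μ.re⌋₊ + 1 : ℕ) : ℂ) := by
      simp only [hl, hn, rlOrder]; ring
    rw [rlIntegral_eq_volterra, h1, (hcomp x hx).2,
      volterra_congr (κ' := fun u => Complex.Gamma l * k (β + l) u) hx.1.le fun t ht =>
        volterra_cpow_macdonaldKernel hη hα hw hsep' hβc hβc hlre ht, h2]
    simp only [volterra, mul_assoc]
    rw [intervalIntegral.integral_const_mul, ← mul_assoc, one_div, inv_mul_cancel₀ hGam, one_mul]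
  obtain ⟨hsmooth, hiter⟩ := htower.contDiffOn_iteratedDeriv hφ ⌊μ.re⌋₊ hrl
  -- the last derivative, at points where the fundamental theorem of calculus holds
  have hlast : ∀ x ∈ Ioo a b,
      HasDerivAt (volterra a (k (β - μ + (1 : ℕ))) φ) (volterra a (k (β - μ + (0 : ℕ))) φ x) x →
      RLDifferentiableAt a μ f x ∧ rlDeriv a μ f x =
        hOperator 2 2 (macdonaldDerivParams η σ ν α β μ) a w α (β - μ) φ x := by
    intro x hx hder
    have hnhds : Ioo a b ∈ 𝓝 x := isOpen_Ioo.mem_nhds hx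
    have hder' : HasDerivAt (iteratedDeriv ⌊μ.re⌋₊ (rlIntegral a l f))
        (volterra a (k (β - μ)) φ x) x := by
      rw [Nat.cast_zero, add_zero] at hder
      exact hder.congr_of_eventuallyEq (hiter.eventuallyEq_of_mem hnhds)
    refine ⟨⟨?_, hsmooth.contDiffAt hnhds, hder'.differentiableAt⟩, ?_⟩
    · filter_upwards [hnhds] with y hy using hrl_int y hy
    · rw [hop₂ x hx, ← hder'.deriv, ← iteratedDeriv_succ]
      rfl
  refine ⟨?_, fun hc x hx => ?_⟩
  · filter_upwards [ae_intervalIntegrable_volterra hβc hsing hφ,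
      ae_intervalIntegrable_volterra hδ hsing0 hφ, htower.ae_hasDerivAt hφ,
      ae_restrict_mem measurableSet_Ioo] with x h1 h2 h3 hx
    obtain ⟨h4, h5⟩ := hlast x hx h3
    exact ⟨(hex₁ x hx).2 h1, h4, (hex₂ x hx).2 h2, h5⟩
  · have hcont : ContinuousOn (volterra a (k (β - μ + (0 : ℕ))) φ) (Ioo a b) := by
      simpa using continuousOn_volterra hδ hsing0 hφ hc
    obtain ⟨h4, h5⟩ := hlast x hx (htower.hasDerivAt_of_continuousOn hφ 0 hcont hx)
    exact ⟨(hex₁ x hx).2 (intervalIntegrable_volterra_of_continuousOn hβc hsing hφ hc hx), h4,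
      (hex₂ x hx).2 (intervalIntegrable_volterra_of_continuousOn hδ hsing0 hφ hc hx), h5⟩
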